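/- Let $(M,h,\nabla)$ and $(M',h',\nabla')$ be connected dually flat manifolds of dimensions $n$ and $d$: $M$ is a smooth manifold with a Riemannian metric $h$ and a linear connection $\nabla$ such that both $\nabla$ and its dual connection $\nabla^{*}$, defined by $X\,h(Y,Z)=h(\nabla_XY,Z)+h(Y,\nabla^{*}_XZ)$ for all vector fields $X,Y,Z$, are flat (have zero torsion and zero curvature); similarly for $M'$. Let $\pi:TM\to M$ be the projection and let $K:TTM\to TM$ be the connector of $\nabla$, that is, the map that is linear on each $T_u(TM)$, with values in $T_{\pi(u)}M$, and satisfies $K(Y_*X)=\nabla_XY$ for all vector fields $X,Y$. For $u\in T_pM$ identify $T_u(TM)$ with $T_pM\oplus T_pM$ by $A\mapsto(\pi_*A,KA)$, and let $$g_u\big((v,w),(\bar v,\bar w)\big)=h_p(v,\bar v)+h_p(w,\bar w),\qquad J_u(v,w)=(-w,v).$$ Endow $TM$ with this almost Hermitian structure $(g,J)$ (Dombrowski's construction), which is Kähler, and define $(g',J')$ on $TM'$ in the same way from $(h',\nabla')$. A coordinate system $(x_1,\dots,x_n)$ on an open subset of $M$ is $\nabla$-affine if $\nabla_{\partial/\partial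 x_i}\partial/\partial x_j=0$ for all $i,j$. A smooth map $f:M\to M'$ is affine if for every $p\in M$ there are a $\nabla$-affine coordinate system $x:U\to\mathbb{R}^n$ and a $\nabla'$-affine coordinate system $x':U'\to\mathbb{R}^d$ such that $p\in U$, $f(U)\subseteq U'$ and $x'\circ f\circ x^{-1}:x(U)\to\mathbb{R}^d$ is the restriction of an affine map $\mathbb{R}^n\to\mathbb{R}^d$. The map $f$ is isometric if $f^{*}h'=h$. The derivative $f_*:TM\to TM'$ is isometric if $(f_*)^{*}g'=g$, and holomorphic if $(f_*)_*\circ J=J'\circ(f_*)_*$; it is a Kähler immersion if it is a holomorphic isometric immersion. Let $f:M\to M'$ be a smooth map. 1. The derivative $f_*:TM\to TM'$ is holomorphic if and only if $f$ is affine. 2. Suppose that $f$ is affine. Then $f_*$ is isometric if and only if $f$ is isometric. Consequently, $f_*$ is a Kähler immersion if and only if $f$ is an isometric affine immersion. -/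

import Mathlib

open Bundle Set
open scoped Manifold ContDiff Topology

noncomputable section

namespace DuallyFlat

/-- Smooth vector fields on a smooth manifold. -/
def IsSmoothField {n : ℕ} {M : Type*} [TopologicalSpace M]
    [ChartedSpace (EuclideanSpace ℝ (Fin n)) M] [IsManifold (𝓡 n) ∞ M]
    (X : ∀ p : M, TangentSpace (𝓡 n) p) : Prop :=
  ContMDiff (𝓡 n) (𝓡 n).tangent ∞ (fun p ↦ (⟨p, X p⟩ : TangentBundle (𝓡 n) M))

/-- Linear connections on the tangent bundle. In Mathlib's convention `D Y p (X p)` is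
`(∇_X Y)(p)`. -/
abbrev Connection (n : ℕ) (M : Type*) [TopologicalSpace M]
    [ChartedSpace (EuclideanSpace ℝ (Fin n)) M] [IsManifold (𝓡 n) ∞ M] :=
  CovariantDerivative (𝓡 n) (EuclideanSpace ℝ (Fin n)) (TangentSpace (𝓡 n) : M → Type _)

/-- Smooth Riemannian metrics. -/
abbrev Metric (n : ℕ) (M : Type*) [TopologicalSpace M]
    [ChartedSpace (EuclideanSpace ℝ (Fin n)) M] [IsManifold (𝓡 n) ∞ M] :=
  ContMDiffRiemannianMetric (𝓡 n) ∞ (EuclideanSpace ℝ (Fin n))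
    (TangentSpace (𝓡 n) : M → Type _)

section Manifold

variable {n : ℕ} {M : Type*} [TopologicalSpace M]
  [ChartedSpace (EuclideanSpace ℝ (Fin n)) M] [IsManifold (𝓡 n) ∞ M]

/-- The vector field `∇_X Y`. -/
def nabla (D : Connection n M) (X Y : ∀ p : M, TangentSpace (𝓡 n) p) (p : M) :
    TangentSpace (𝓡 n) p :=
  D Y p (X p)

/-- The curvature `R(X,Y)Z = ∇_X ∇_Y Z - ∇_Y ∇_X Z - ∇_[X,Y] Z`. -/
def curvature (D : Connection n M) (X Y Z : ∀ p : M, TangentSpace (𝓡 n) p) (p : M) :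
    TangentSpace (𝓡 n) p :=
  nabla D X (nabla D Y Z) p - nabla D Y (nabla D X Z) p
    - nabla D (VectorField.mlieBracket (𝓡 n) X Y) Z p

/-- A connection is flat if its torsion and its curvature vanish identically. -/
structure IsFlat (D : Connection n M) : Prop where
  torsion_eq_zero : ∀ p : M, D.torsion p = 0
  curvature_eq_zero : ∀ X Y Z : ∀ p : M, TangentSpace (𝓡 n) p,
    IsSmoothField X → IsSmoothField Y → IsSmoothField Z → ∀ p, curvature D X Y Z p = 0

/-- `D'` is dual to `D` with respect to `h`:
`X h(Y,Z) = h(∇_X Y, Z) + h(Y, ∇*_X Z)` for all smooth vector fields. -/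
def IsDual (h : Metric n M) (D D' : Connection n M) : Prop :=
  ∀ X Y Z : ∀ p : M, TangentSpace (𝓡 n) p,
    IsSmoothField X → IsSmoothField Y → IsSmoothField Z → ∀ p,
      mvfderiv (𝓡 n) (fun q ↦ h.inner q (Y q) (Z q)) p (X p)
        = h.inner p (nabla D X Y p) (Z p) + h.inner p (Y p) (nabla D' X Z p)

/-- The field `∑ vⱼ ∂/∂xⱼ` of a chart `x`, for a constant `v ∈ ℝⁿ`: at each point of the source
of `x` it is the preimage of `v` under the derivative of `x`. -/
def coordField (x : OpenPartialHomeomorph M (EuclideanSpace ℝ (Fin n)))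
    (v : EuclideanSpace ℝ (Fin n)) (p : M) : TangentSpace (𝓡 n) p :=
  VectorField.mpullback (𝓡 n) (𝓡 n) x (fun _ ↦ v) p

/-- `x` is a smooth chart of `M` with `∇_{∂/∂xᵢ} ∂/∂xⱼ = 0` on its domain. -/
structure IsAffineChart (D : Connection n M)
    (x : OpenPartialHomeomorph M (EuclideanSpace ℝ (Fin n))) : Prop where
  mem_maximalAtlas : x ∈ IsManifold.maximalAtlas (𝓡 n) ∞ M
  nabla_eq_zero : ∀ i j : Fin n, ∀ p ∈ x.source,
    nabla D (coordField x (EuclideanSpace.single i 1))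
      (coordField x (EuclideanSpace.single j 1)) p = 0

/-- The derivative `π_*` of the projection `π : TM → M` at `u`. -/
def projDeriv (u : TangentBundle (𝓡 n) M) :
    TangentSpace (𝓡 n).tangent u →L[ℝ] TangentSpace (𝓡 n) u.proj :=
  mfderiv (𝓡 n).tangent (𝓡 n) (TotalSpace.proj : TangentBundle (𝓡 n) M → M) u

/-- The vertical coordinates `(r₁, …, rₙ)` of a vector in `T_u(TM)`. Here `T_u(TM)` is
`ℝⁿ × ℝⁿ` and `T_pM`, `p = π(u)`, is `ℝⁿ`, both by means of the preferred chart at `p`: the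
pair `(a, b)` is `∑ aᵢ ∂/∂qᵢ + bᵢ ∂/∂rᵢ`, and its vertical coordinates `b` stand for
`∑ bᵢ ∂/∂xᵢ`. -/
def vertCoord (u : TangentBundle (𝓡 n) M) :
    TangentSpace (𝓡 n).tangent u →L[ℝ] TangentSpace (𝓡 n) u.proj :=
  ContinuousLinearMap.snd ℝ (EuclideanSpace ℝ (Fin n)) (EuclideanSpace ℝ (Fin n))

/-- The connector `K_u : T_u(TM) → T_pM` of `∇`, in the preferred chart `x` at `p = π(u)`:
`K_u(∑ aᵢ ∂/∂qᵢ + bᵢ ∂/∂rᵢ) = ∑ bᵢ ∂/∂xᵢ + ∑ aᵢ uⱼ ∇_{∂/∂xᵢ} ∂/∂xⱼ`. -/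
def connector (D : Connection n M) (u : TangentBundle (𝓡 n) M) :
    TangentSpace (𝓡 n).tangent u →L[ℝ] TangentSpace (𝓡 n) u.proj :=
  vertCoord u + (D (coordField (chartAt (EuclideanSpace ℝ (Fin n)) u.proj) u.snd) u.proj).comp
    (projDeriv u)

theorem projDeriv_apply (u : TangentBundle (𝓡 n) M) (A : TangentSpace (𝓡 n).tangent u) :
    projDeriv u A
      = (ContinuousLinearMap.fst ℝ (EuclideanSpace ℝ (Fin n)) (EuclideanSpace ℝ (Fin n)) A) := by
  have key : HasMFDerivAt (𝓡 n).tangent (𝓡 n) (TotalSpace.proj : TangentBundle (𝓡 n) M → M) u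
      (ContinuousLinearMap.fst ℝ (EuclideanSpace ℝ (Fin n)) (EuclideanSpace ℝ (Fin n))) := by
    have h1 : ∀ y ∈ (extChartAt (𝓡 n).tangent u).target,
        writtenInExtChartAt (𝓡 n).tangent (𝓡 n) u
          (TotalSpace.proj : TangentBundle (𝓡 n) M → M) y = y.1 := by
      intro y hy
      simp only [mfld_simps] at hy
      simp only [mfld_simps]
      exact (chartAt _ u.proj).right_inv ((TangentBundle.mem_chart_target_iff _ u).1 hy)
    refine ⟨(FiberBundle.continuous_proj _ _).continuousAt, ?_⟩
    refine HasFDerivWithinAt.congr_of_eventuallyEq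
      (ContinuousLinearMap.hasFDerivWithinAt _) ?_ ?_
    · filter_upwards [extChartAt_target_mem_nhdsWithin (I := (𝓡 n).tangent) u] with y hy
      exact h1 y hy
    · exact h1 _ (mem_extChartAt_target u)
  unfold projDeriv
  rw [key.mfderiv]
  rfl

/-- `A ↦ (π_* A, K A)`, as a map `T_u(TM) → T_pM ⊕ T_pM`. -/
def split (D : Connection n M) (u : TangentBundle (𝓡 n) M) :
    TangentSpace (𝓡 n).tangent u →ₗ[ℝ] TangentSpace (𝓡 n) u.proj × TangentSpace (𝓡 n) u.proj :=
  ((projDeriv u).prod (connector D u)).toLinearMap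

theorem split_bijective (D : Connection n M) (u : TangentBundle (𝓡 n) M) :
    Function.Bijective (split D u) := by
  set L := D (coordField (chartAt (EuclideanSpace ℝ (Fin n)) u.proj) u.snd) u.proj
  have hs : ∀ A : TangentSpace (𝓡 n).tangent u,
      split D u A = (projDeriv u A, vertCoord u A + L (projDeriv u A)) := fun A ↦ rfl
  have hinj : ∀ A B : TangentSpace (𝓡 n).tangent u, projDeriv u A = projDeriv u B →
      vertCoord u A = vertCoord u B → A = B := by
    intro A B h1 h2
    rw [projDeriv_apply, projDeriv_apply] at h1
    exact Prod.ext h1 h2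
  constructor
  · intro A B h
    rw [hs, hs, Prod.mk.injEq] at h
    refine hinj A B h.1 ?_
    have h2 := h.2
    rw [h.1] at h2
    exact add_right_cancel h2
  · rintro ⟨v, w⟩
    let A : TangentSpace (𝓡 n).tangent u :=
      ((v, w - L v) : EuclideanSpace ℝ (Fin n) × EuclideanSpace ℝ (Fin n))
    have h1 : projDeriv u A = v := projDeriv_apply u A
    have h2 : vertCoord u A = w - L v := rfl
    refine ⟨A, ?_⟩
    rw [hs, h1, h2, sub_add_cancel]

/-- The identification `T_u(TM) ≅ T_pM ⊕ T_pM` given by a connection. -/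
def splitEquiv (D : Connection n M) (u : TangentBundle (𝓡 n) M) :
    TangentSpace (𝓡 n).tangent u ≃ₗ[ℝ] TangentSpace (𝓡 n) u.proj × TangentSpace (𝓡 n) u.proj :=
  LinearEquiv.ofBijective (split D u) (split_bijective D u)

/-- The almost complex structure `J_u(v, w) = (-w, v)` of Dombrowski's construction. -/
def complexStructure (D : Connection n M) (u : TangentBundle (𝓡 n) M)
    (A : TangentSpace (𝓡 n).tangent u) : TangentSpace (𝓡 n).tangent u :=
  (splitEquiv D u).symm (-(splitEquiv D u A).2, (splitEquiv D u A).1)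

/-- The metric `g_u((v, w), (v', w')) = h_p(v, v') + h_p(w, w')` of Dombrowski's construction. -/
def tangentMetric (h : Metric n M) (D : Connection n M) (u : TangentBundle (𝓡 n) M)
    (A B : TangentSpace (𝓡 n).tangent u) : ℝ :=
  h.inner u.proj (splitEquiv D u A).1 (splitEquiv D u B).1
    + h.inner u.proj (splitEquiv D u A).2 (splitEquiv D u B).2

end Manifold

/-- A dually flat structure `(h, ∇, ∇*)` on a smooth manifold. -/
structure DuallyFlatStructure (n : ℕ) (M : Type*) [TopologicalSpace M]
    [ChartedSpace (EuclideanSpace ℝ (Fin n)) M] [IsManifold (𝓡 n) ∞ M] where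
  /-- the Riemannian metric `h` -/
  metric : Metric n M
  /-- the connection `∇` -/
  conn : Connection n M
  /-- the dual connection `∇*` -/
  dualConn : Connection n M
  smooth_conn : conn.ContMDiffCovariantDerivative ∞
  smooth_dualConn : dualConn.ContMDiffCovariantDerivative ∞
  isDual : IsDual metric conn dualConn
  flat_conn : IsFlat conn
  flat_dualConn : IsFlat dualConn

/-- `f` is affine: near every point it is, in suitable affine charts, the restriction of an
affine map `ℝⁿ → ℝᵈ`. -/
def IsAffine {n d : ℕ} {M M' : Type*}
    [TopologicalSpace M] [ChartedSpace (EuclideanSpace ℝ (Fin n)) M] [IsManifold (𝓡 n) ∞ M]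
    [TopologicalSpace M'] [ChartedSpace (EuclideanSpace ℝ (Fin d)) M'] [IsManifold (𝓡 d) ∞ M']
    (D : Connection n M) (D' : Connection d M') (f : M → M') : Prop :=
  ∀ p : M, ∃ (x : OpenPartialHomeomorph M (EuclideanSpace ℝ (Fin n)))
    (x' : OpenPartialHomeomorph M' (EuclideanSpace ℝ (Fin d)))
    (a : EuclideanSpace ℝ (Fin n) →ᵃ[ℝ] EuclideanSpace ℝ (Fin d)),
    IsAffineChart D x ∧ IsAffineChart D' x' ∧ p ∈ x.source ∧ MapsTo f x.source x'.source ∧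
      ∀ y ∈ x.target, x' (f (x.symm y)) = a y

section Maps

variable {E H E' H' : Type*} [NormedAddCommGroup E] [NormedSpace ℝ E] [TopologicalSpace H]
  [NormedAddCommGroup E'] [NormedSpace ℝ E'] [TopologicalSpace H']
  (I : ModelWithCorners ℝ E H) (I' : ModelWithCorners ℝ E' H')
  {N N' : Type*} [TopologicalSpace N] [ChartedSpace H N] [TopologicalSpace N'] [ChartedSpace H' N']

/-- A smooth map whose derivative commutes with the (almost) complex structures. -/
def IsHolomorphic (J : ∀ q : N, TangentSpace I q → TangentSpace I q)
    (J' : ∀ q : N', TangentSpace I' q → TangentSpace I' q) (F : N → N') : Prop :=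
  ContMDiff I I' ∞ F ∧
    ∀ (q : N) (A : TangentSpace I q), mfderiv I I' F q (J q A) = J' (F q) (mfderiv I I' F q A)

/-- A smooth map with `F^* g' = g`. -/
def IsIsometric (g : ∀ q : N, TangentSpace I q → TangentSpace I q → ℝ)
    (g' : ∀ q : N', TangentSpace I' q → TangentSpace I' q → ℝ) (F : N → N') : Prop :=
  ContMDiff I I' ∞ F ∧
    ∀ (q : N) (A B : TangentSpace I q),
      g' (F q) (mfderiv I I' F q A) (mfderiv I I' F q B) = g q A B

/-- A smooth map with injective derivative at every point. -/
def IsSmoothImmersion (F : N → N') : Prop :=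
  ContMDiff I I' ∞ F ∧ ∀ q : N, Function.Injective (mfderiv I I' F q)

/-- A holomorphic isometric immersion. -/
def IsKahlerImmersion (g : ∀ q : N, TangentSpace I q → TangentSpace I q → ℝ)
    (J : ∀ q : N, TangentSpace I q → TangentSpace I q)
    (g' : ∀ q : N', TangentSpace I' q → TangentSpace I' q → ℝ)
    (J' : ∀ q : N', TangentSpace I' q → TangentSpace I' q) (F : N → N') : Prop :=
  IsSmoothImmersion I I' F ∧ IsHolomorphic I I' J J' F ∧ IsIsometric I I' g g' F

end Maps

end DuallyFlat

end

/-!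
Under the splitting `A ↦ (π_* A, K A)`, the derivative `f_**` has first component `f_* (π_* A)`,
while its second component is `f_* (K A)` exactly where `K' ∘ f_** = f_* ∘ K`. In affine charts of
`∇` and `∇'` the connectors are the vertical components, and `f_**` is the derivative of
`(q, r) ↦ (φ q, dφ_q r)`, where `φ` is the expression of `f`; so `K' ∘ f_** - f_* ∘ K` is the second
derivative of `φ`, which vanishes exactly when `f` is affine. Since `J` exchanges the two components
up to sign, commuting with `J` is the same condition, and once it holds `f_**` acts as `f_* ⊕ f_*`,
from which the metric statements follow.

The affine charts around each point come from flatness. With `Γ` the Christoffel symbols in a chart,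
the equation `dη = η Γ` for a parallel coframe is integrable because the curvature vanishes, and the
coframe is closed, hence exact, because the torsion vanishes; its primitive is the affine chart. The
integrability theorem is proved by solving the equation along rays and checking, with Grönwall's
inequality, that the resulting function has the required derivative.
-/

noncomputable section

namespace DuallyFlat

open scoped NNReal

local notation "𝔼" n:max => EuclideanSpace ℝ (Fin n)

section Frobenius

variable {E F W : Type*} [NormedAddCommGroup E] [NormedSpace ℝ E]
  [NormedAddCommGroup F] [NormedSpace ℝ F] [NormedAddCommGroup W] [NormedSpace ℝ W]

/-- The integrability condition at `y` of the total differential equation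
`dZ_y(u) = A(y)(u) Z(y)`: the symmetry in `u` and `v` of the second derivative of a solution. -/
def IsIntegrableAt (A : E → E →L[ℝ] W →L[ℝ] W) (y : E) : Prop :=
  ∀ u v, fderiv ℝ A y u v + A y v ∘L A y u = fderiv ℝ A y v u + A y u ∘L A y v

/-- `A` is of class `C^{1,1}` on the ball of radius `r` about the origin, and `K` bounds `A`, its
derivative, and the Lipschitz constant of its derivative. -/
structure HasC11Bound (A : E → F) (K : ℝ≥0) (r : ℝ) : Prop where
  differentiableAt : ∀ y ∈ Metric.ball (0 : E) r, DifferentiableAt ℝ A y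
  norm_le : ∀ y ∈ Metric.ball (0 : E) r, ‖A y‖ ≤ K
  norm_fderiv_le : ∀ y ∈ Metric.ball (0 : E) r, ‖fderiv ℝ A y‖ ≤ K
  lipschitzOnWith_fderiv : LipschitzOnWith K (fderiv ℝ A) (Metric.ball 0 r)

theorem HasC11Bound.mono {A : E → F} {K : ℝ≥0} {r r' : ℝ} (hA : HasC11Bound A K r)
    (hr : r' ≤ r) : HasC11Bound A K r' where
  differentiableAt y hy := hA.differentiableAt y (Metric.ball_subset_ball hr hy)
  norm_le y hy := hA.norm_le y (Metric.ball_subset_ball hr hy)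
  norm_fderiv_le y hy := hA.norm_fderiv_le y (Metric.ball_subset_ball hr hy)
  lipschitzOnWith_fderiv := hA.lipschitzOnWith_fderiv.mono (Metric.ball_subset_ball hr)

theorem exists_hasC11Bound {A : E → F} (hA : ContDiffAt ℝ 2 A 0) :
    ∃ K, ∃ r > 0, HasC11Bound A K r := by
  have hA' : ContDiffAt ℝ 1 (fderiv ℝ A) 0 := hA.fderiv_right (by norm_num)
  obtain ⟨C, s, hs, hC⟩ := hA'.exists_lipschitzOnWith
  have hdiff : ∀ᶠ y in 𝓝 (0 : E), DifferentiableAt ℝ A y :=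
    (hA.eventually (by simp)).mono fun y hy ↦ hy.differentiableAt two_ne_zero
  have hle : ∀ᶠ y in 𝓝 (0 : E), ‖A y‖₊ ≤ ‖A 0‖₊ + 1 :=
    (hA.continuousAt.nnnorm.eventually_lt_const (lt_add_one _)).mono fun _ ↦ le_of_lt
  have hle' : ∀ᶠ y in 𝓝 (0 : E), ‖fderiv ℝ A y‖₊ ≤ ‖fderiv ℝ A 0‖₊ + 1 :=
    (hA'.continuousAt.nnnorm.eventually_lt_const (lt_add_one _)).mono fun _ ↦ le_of_lt
  obtain ⟨r, hr, hball⟩ := Metric.eventually_nhds_iff_ball.1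
    (Filter.Eventually.and hs (hdiff.and (hle.and hle')))
  set K := C ⊔ ((‖A 0‖₊ + 1) ⊔ (‖fderiv ℝ A 0‖₊ + 1))
  exact ⟨K, r, hr,
    { differentiableAt := fun y hy ↦ (hball y hy).2.1
      norm_le := fun y hy ↦
        NNReal.coe_le_coe.2 ((hball y hy).2.2.1.trans (le_sup_of_le_right le_sup_left))
      norm_fderiv_le := fun y hy ↦
        NNReal.coe_le_coe.2 ((hball y hy).2.2.2.trans (le_sup_of_le_right le_sup_right))
      lipschitzOnWith_fderiv := (hC.weaken le_sup_left).mono fun y hy ↦ (hball y hy).1 }⟩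

theorem HasC11Bound.norm_sub_le {A : E → F} {K : ℝ≥0} {r : ℝ} (hA : HasC11Bound A K r) {y z : E}
    (hy : y ∈ Metric.ball 0 r) (hz : z ∈ Metric.ball 0 r) : ‖A z - A y‖ ≤ K * ‖z - y‖ :=
  (convex_ball 0 r).norm_image_sub_le_of_norm_hasFDerivWithin_le
    (fun w hw ↦ (hA.differentiableAt w hw).hasFDerivAt.hasFDerivWithinAt) hA.norm_fderiv_le hy hz

theorem HasC11Bound.norm_sub_sub_fderiv_le {A : E → F} {K : ℝ≥0} {r : ℝ}
    (hA : HasC11Bound A K r) {y z : E} (hy : y ∈ Metric.ball 0 r) (hz : z ∈ Metric.ball 0 r) :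
    ‖A z - A y - fderiv ℝ A y (z - y)‖ ≤ K * ‖z - y‖ ^ 2 := by
  have hseg : segment ℝ y z ⊆ Metric.ball 0 r := (convex_ball 0 r).segment_subset hy hz
  have hvar : ∀ w ∈ segment ℝ y z, ‖fderiv ℝ A w - fderiv ℝ A y‖ ≤ K * ‖z - y‖ := fun w hw ↦
    (hA.lipschitzOnWith_fderiv.norm_sub_le (hseg hw) hy).trans <| by
      gcongr
      exact norm_sub_le_of_mem_segment hw
  calc ‖A z - A y - fderiv ℝ A y (z - y)‖ ≤ K * ‖z - y‖ * ‖z - y‖ :=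
        (convex_segment y z).norm_image_sub_le_of_norm_hasFDerivWithin_le'
          (fun w hw ↦ (hA.differentiableAt w (hseg hw)).hasFDerivAt.hasFDerivWithinAt) hvar
          (left_mem_segment ℝ y z) (right_mem_segment ℝ y z)
    _ = K * ‖z - y‖ ^ 2 := by ring

-- Without these two shortcuts, the search for the norms on spaces of multilinear maps times out.
local instance normedAddCommGroupEnd : NormedAddCommGroup (W →L[ℝ] W) :=
  ContinuousLinearMap.toNormedAddCommGroup

local instance normedSpaceEnd : NormedSpace ℝ (W →L[ℝ] W) :=
  ContinuousLinearMap.toNormedSpace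

/-- `φ` solves on `[0, 1]` the equation `φ' = A(tx)(x) φ`, the restriction of the total
differential equation `dZ = A Z` to the ray through `x`, with initial value `z₀`. -/
structure IsRaySolution (A : E → E →L[ℝ] W →L[ℝ] W) (z₀ : W) (x : E) (φ : ℝ → W) : Prop where
  apply_zero : φ 0 = z₀
  hasDerivWithinAt : ∀ t ∈ Icc (0 : ℝ) 1, HasDerivWithinAt φ (A (t • x) x (φ t)) (Icc 0 1) t

theorem smul_mem_ball_zero {x : E} {r t : ℝ} (hx : x ∈ Metric.ball 0 r) (ht : t ∈ Icc (0 : ℝ) 1) :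
    t • x ∈ Metric.ball 0 r :=
  balanced_ball_zero.smul_mem (by simpa [abs_of_nonneg ht.1] using ht.2) hx

variable {A : E → E →L[ℝ] W →L[ℝ] W} {K : ℝ≥0} {r : ℝ} {z₀ : W} {x h : E} {φ ψ : ℝ → W}

theorem IsRaySolution.continuousOn (hφ : IsRaySolution A z₀ x φ) : ContinuousOn φ (Icc 0 1) :=
  fun t ht ↦ (hφ.hasDerivWithinAt t ht).continuousWithinAt

theorem IsRaySolution.apply_one_of_zero (hφ : IsRaySolution A z₀ 0 φ) : φ 1 = z₀ := by
  have hbound := (convex_Icc (0 : ℝ) 1).norm_image_sub_le_of_norm_hasDerivWithin_le (C := 0)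
    hφ.hasDerivWithinAt (by simp) (left_mem_Icc.2 zero_le_one) (right_mem_Icc.2 zero_le_one)
  rw [zero_mul, norm_le_zero_iff, sub_eq_zero] at hbound
  exact hbound.trans hφ.apply_zero

theorem exists_isRaySolution [CompleteSpace W] (hcont : ContinuousOn A (Metric.ball 0 r))
    (hK : ∀ y ∈ Metric.ball (0 : E) r, ‖A y‖ ≤ K) (hr : K * r * (‖z₀‖ + 1) ≤ 1)
    (hx : x ∈ Metric.ball (0 : E) r) : ∃ φ, IsRaySolution A z₀ x φ := by
  have hxr : ‖x‖ ≤ r := (mem_ball_zero_iff.1 hx).le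
  have hop : ∀ t ∈ Icc (0 : ℝ) 1, ‖A (t • x) x‖ ≤ K * r := fun t ht ↦
    (A (t • x)).le_of_opNorm_le_of_le (hK _ (smul_mem_ball_zero hx ht)) hxr
  have hKr : 0 ≤ K * r := mul_nonneg K.2 ((norm_nonneg x).trans hxr)
  have hPL : IsPicardLindelof (fun t φ ↦ A (t • x) x φ) (⟨0, by simp⟩ : Icc (0 : ℝ) 1) z₀ 1 0 1
      ⟨K * r, hKr⟩ :=
    { lipschitzOnWith := fun t ht ↦ ((A (t • x) x).lipschitz.weaken (hop t ht)).lipschitzOnWith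
      continuousOn := fun z _ ↦ by
        have hray : ContinuousOn (fun t : ℝ ↦ A (t • x)) (Icc 0 1) :=
          hcont.comp (by fun_prop) fun t ht ↦ smul_mem_ball_zero hx ht
        exact (hray.clm_apply continuousOn_const).clm_apply continuousOn_const
      norm_le := fun t ht z hz ↦ by
        have hz' : ‖z‖ ≤ ‖z₀‖ + 1 := norm_le_of_mem_closedBall hz
        exact ((A (t • x) x).le_of_opNorm_le_of_le (hop t ht) hz').trans hr
      mul_max_le := by simp }
  obtain ⟨φ, hφ₀, hφ⟩ := hPL.exists_eq_forall_mem_Icc_hasDerivWithinAt₀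
  exact ⟨φ, hφ₀, hφ⟩

-- The first order variation of a solution along `x` in the direction `h` should be `t A(tx)(h) φ`:
-- integrability makes it solve the equation along `x + h` up to an error quadratic in `h`.
theorem IsRaySolution.hasDerivWithinAt_add_smul (hφ : IsRaySolution A z₀ x φ) {t : ℝ}
    (ht : t ∈ Icc (0 : ℝ) 1) (hA : DifferentiableAt ℝ A (t • x)) :
    HasDerivWithinAt (fun t ↦ φ t + t • A (t • x) h (φ t))
      (A (t • x) x (φ t) + (A (t • x) h (φ t)
        + t • (fderiv ℝ A (t • x) x h (φ t) + A (t • x) h (A (t • x) x (φ t))))) (Icc 0 1) t := by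
  have hray : HasDerivWithinAt (fun t : ℝ ↦ t • x) x (Icc 0 1) t := by
    simpa using (hasDerivWithinAt_id t (Icc (0 : ℝ) 1)).smul_const x
  have hAray : HasDerivWithinAt (fun t : ℝ ↦ A (t • x) h) (fderiv ℝ A (t • x) x h) (Icc 0 1) t := by
    simpa using (hA.hasFDerivAt.comp_hasDerivWithinAt t hray).clm_apply
      (hasDerivWithinAt_const t _ h)
  have hsum := (hφ.hasDerivWithinAt t ht).add
    ((hasDerivWithinAt_id t (Icc (0 : ℝ) 1)).smul (hAray.clm_apply (hφ.hasDerivWithinAt t ht)))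
  convert! hsum using 1
  simp only [id, one_smul]
  abel

theorem variation_sub_eq {A₀ A₁ : E →L[ℝ] W →L[ℝ] W} {D : E →L[ℝ] E →L[ℝ] W →L[ℝ] W}
    (hI : D x h + A₀ h ∘L A₀ x = D h x + A₀ x ∘L A₀ h) (t : ℝ) (w : W) :
    A₀ x w + (A₀ h w + t • (D x h w + A₀ h (A₀ x w))) - A₁ (x + h) (w + t • A₀ h w)
      = -(t • D h h w + (A₁ - A₀ - D (t • h)) (x + h) w + t • (A₁ - A₀) x (A₀ h w)
        + t • A₁ h (A₀ h w)) := by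
  have hIw : D x h w + A₀ h (A₀ x w) = D h x w + A₀ x (A₀ h w) := by
    simpa using congrArg (fun L : W →L[ℝ] W ↦ L w) hI
  rw [hIw]
  simp only [map_add, map_smul, add_apply, sub_apply, smul_apply, smul_add, smul_sub]
  abel

theorem norm_variation_sub_le {A₀ A₁ : E →L[ℝ] W →L[ℝ] W} {D : E →L[ℝ] E →L[ℝ] W →L[ℝ] W}
    {t m : ℝ} {w : W} (h₀ : ‖A₀‖ ≤ K) (h₁ : ‖A₁‖ ≤ K) (hD : ‖D‖ ≤ K) (ht : t ∈ Icc (0 : ℝ) 1)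
    (hx : ‖x‖ ≤ 1) (hxh : ‖x + h‖ ≤ 1) (hlip : ‖A₁ - A₀‖ ≤ K * ‖t • h‖)
    (htaylor : ‖A₁ - A₀ - D (t • h)‖ ≤ K * ‖t • h‖ ^ 2)
    (hI : D x h + A₀ h ∘L A₀ x = D h x + A₀ x ∘L A₀ h) (hw : ‖w‖ ≤ m) :
    ‖A₀ x w + (A₀ h w + t • (D x h w + A₀ h (A₀ x w))) - A₁ (x + h) (w + t • A₀ h w)‖
      ≤ (2 * K + 2 * K ^ 2) * m * ‖h‖ ^ 2 := by
  have : 0 ≤ m := (norm_nonneg _).trans hw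
  have ht_smul (v : W) : ‖t • v‖ ≤ ‖v‖ := by
    simpa [norm_smul, abs_of_nonneg ht.1] using mul_le_of_le_one_left (norm_nonneg v) ht.2
  have ht_h : ‖t • h‖ ≤ ‖h‖ := by
    simpa [norm_smul, abs_of_nonneg ht.1] using mul_le_of_le_one_left (norm_nonneg h) ht.2
  have hA₀hw : ‖A₀ h w‖ ≤ K * ‖h‖ * m := (A₀.le_opNorm₂ h w).trans (by gcongr)
  have hsecond : ‖t • D h h w‖ ≤ K * ‖h‖ * ‖h‖ * m :=
    (ht_smul _).trans (((D h).le_opNorm₂ h w).trans (by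
      gcongr
      exact D.le_of_opNorm_le hD h))
  have hremainder : ‖(A₁ - A₀ - D (t • h)) (x + h) w‖ ≤ K * ‖h‖ ^ 2 * 1 * m :=
    ((A₁ - A₀ - D (t • h)).le_opNorm₂ _ _).trans (by
      gcongr
      exact htaylor.trans (by gcongr))
  have hdiff : ‖t • (A₁ - A₀) x (A₀ h w)‖ ≤ K * ‖h‖ * 1 * (K * ‖h‖ * m) :=
    (ht_smul _).trans (((A₁ - A₀).le_opNorm₂ _ _).trans (by
      gcongr
      exact hlip.trans (by gcongr)))
  have hlast : ‖t • A₁ h (A₀ h w)‖ ≤ K * ‖h‖ * (K * ‖h‖ * m) :=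
    (ht_smul _).trans ((A₁.le_opNorm₂ _ _).trans (by gcongr))
  rw [variation_sub_eq hI, norm_neg]
  calc _ ≤ K * ‖h‖ * ‖h‖ * m + K * ‖h‖ ^ 2 * 1 * m + K * ‖h‖ * 1 * (K * ‖h‖ * m)
          + K * ‖h‖ * (K * ‖h‖ * m) :=
        norm_add₄_le.trans (by gcongr)
    _ = (2 * K + 2 * K ^ 2) * m * ‖h‖ ^ 2 := by ring

theorem IsRaySolution.norm_sub_le_gronwallBound {χ χ' : ℝ → W} {ε : ℝ}
    (hψ : IsRaySolution A z₀ x ψ) (hK : ∀ t ∈ Icc (0 : ℝ) 1, ‖A (t • x) x‖ ≤ K)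
    (hχ₀ : χ 0 = z₀) (hχ : ∀ t ∈ Icc (0 : ℝ) 1, HasDerivWithinAt χ (χ' t) (Icc 0 1) t)
    (hε : ∀ t ∈ Icc (0 : ℝ) 1, ‖χ' t - A (t • x) x (χ t)‖ ≤ ε) :
    ‖ψ 1 - χ 1‖ ≤ gronwallBound 0 K ε 1 := by
  have hIcc : ∀ {t : ℝ}, t ∈ Ico (0 : ℝ) 1 → t ∈ Icc (0 : ℝ) 1 := fun ht ↦ Ico_subset_Icc_self ht
  have hIci : ∀ t ∈ Ico (0 : ℝ) 1, Icc (0 : ℝ) 1 ∈ 𝓝[≥] t := fun t ht ↦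
    Filter.mem_of_superset (Icc_mem_nhdsGE ht.2) (Icc_subset_Icc_left ht.1)
  have hgronwall := dist_le_of_approx_trajectories_ODE_of_mem (a := 0) (b := 1) (δ := 0) (εg := 0)
    (v := fun t ↦ A (t • x) x) (s := fun _ ↦ univ)
    (fun t ht ↦ ((A (t • x) x).lipschitz.weaken (hK t (hIcc ht))).lipschitzOnWith)
    (fun t ht ↦ (hχ t ht).continuousWithinAt)
    (fun t ht ↦ (hχ t (hIcc ht)).mono_of_mem_nhdsWithin (hIci t ht))
    (fun t ht ↦ (dist_eq_norm _ _).trans_le (hε t (hIcc ht))) (fun _ _ ↦ mem_univ _)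
    hψ.continuousOn
    (fun t ht ↦ (hψ.hasDerivWithinAt t (hIcc ht)).mono_of_mem_nhdsWithin (hIci t ht))
    (fun t _ ↦ (dist_self _).le) (fun _ _ ↦ mem_univ _)
    (by simp [hχ₀, hψ.apply_zero]) 1 (right_mem_Icc.2 zero_le_one)
  simpa [dist_comm, dist_eq_norm] using hgronwall

theorem gronwallBound_zero_left (K ε t : ℝ) :
    gronwallBound 0 K ε t = gronwallBound 0 K 1 t * ε := by
  unfold gronwallBound
  split_ifs <;> ring

theorem IsRaySolution.norm_sub_sub_le (hA : HasC11Bound A K r) (hr : r ≤ 1)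
    (hI : ∀ y ∈ Metric.ball 0 r, IsIntegrableAt A y) (hx : x ∈ Metric.ball 0 r)
    (hxh : x + h ∈ Metric.ball 0 r) (hφ : IsRaySolution A z₀ x φ)
    (hψ : IsRaySolution A z₀ (x + h) ψ) {m : ℝ} (hm : ∀ t ∈ Icc (0 : ℝ) 1, ‖φ t‖ ≤ m) :
    ‖ψ 1 - φ 1 - A x h (φ 1)‖
      ≤ gronwallBound 0 K 1 1 * ((2 * K + 2 * K ^ 2) * m) * ‖h‖ ^ 2 := by
  have hx' : ‖x‖ ≤ 1 := (mem_ball_zero_iff.1 hx).le.trans hr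
  have hxh' : ‖x + h‖ ≤ 1 := (mem_ball_zero_iff.1 hxh).le.trans hr
  have hnorm : ∀ t ∈ Icc (0 : ℝ) 1, ‖A (t • (x + h)) (x + h)‖ ≤ K := fun t ht ↦
    ((A _).le_of_opNorm_le_of_le (hA.norm_le _ (smul_mem_ball_zero hxh ht)) hxh').trans_eq
      (mul_one _)
  have herror : ∀ t ∈ Icc (0 : ℝ) 1,
      ‖A (t • x) x (φ t) + (A (t • x) h (φ t) + t • (fderiv ℝ A (t • x) x h (φ t)
          + A (t • x) h (A (t • x) x (φ t))))
        - A (t • (x + h)) (x + h) (φ t + t • A (t • x) h (φ t))‖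
      ≤ (2 * K + 2 * K ^ 2) * m * ‖h‖ ^ 2 := by
    intro t ht
    have hxt := smul_mem_ball_zero hx ht
    have hxht := smul_mem_ball_zero hxh ht
    have hsub : t • (x + h) - t • x = t • h := by rw [smul_add, add_sub_cancel_left]
    exact norm_variation_sub_le (hA.norm_le _ hxt) (hA.norm_le _ hxht) (hA.norm_fderiv_le _ hxt)
      ht hx' hxh' (hsub ▸ hA.norm_sub_le hxt hxht) (hsub ▸ hA.norm_sub_sub_fderiv_le hxt hxht)
      (hI _ hxt x h) (hm t ht)
  have hclose := hψ.norm_sub_le_gronwallBound hnorm (by simp [hφ.apply_zero])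
    (fun t ht ↦ hφ.hasDerivWithinAt_add_smul ht
      (hA.differentiableAt _ (smul_mem_ball_zero hx ht))) herror
  rw [gronwallBound_zero_left] at hclose
  simpa [sub_sub, mul_assoc] using hclose

theorem exists_hasFDerivAt_ball_zero [CompleteSpace W] (hA : HasC11Bound A K r) (hr₀ : 0 < r)
    (hr₁ : r ≤ 1) (hr : K * r * (‖z₀‖ + 1) ≤ 1)
    (hI : ∀ y ∈ Metric.ball 0 r, IsIntegrableAt A y) :
    ∃ Z : E → W, Z 0 = z₀ ∧ ∀ x ∈ Metric.ball 0 r, HasFDerivAt Z ((A x).flip (Z x)) x := by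
  have hcont : ContinuousOn A (Metric.ball 0 r) := fun y hy ↦
    (hA.differentiableAt y hy).continuousAt.continuousWithinAt
  have hex : ∀ x ∈ Metric.ball (0 : E) r, ∃ φ, IsRaySolution A z₀ x φ := fun x hx ↦
    exists_isRaySolution hcont hA.norm_le hr hx
  choose! φ hφ using hex
  refine ⟨fun x ↦ φ x 1, (hφ 0 (Metric.mem_ball_self hr₀)).apply_one_of_zero, fun x hx ↦ ?_⟩
  obtain ⟨m, hm⟩ := isCompact_Icc.exists_bound_of_continuousOn (hφ x hx).continuousOn
  have hquad : (fun y ↦ φ y 1 - φ x 1 - (A x).flip (φ x 1) (y - x)) =O[𝓝 x]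
      fun y ↦ ‖y - x‖ ^ 2 := by
    refine Asymptotics.IsBigO.of_bound
      (gronwallBound 0 K 1 1 * ((2 * K + 2 * K ^ 2) * m)) ?_
    filter_upwards [Metric.isOpen_ball.mem_nhds hx] with y hy
    obtain ⟨h, rfl⟩ : ∃ h, y = x + h := ⟨y - x, (add_sub_cancel x y).symm⟩
    simpa only [ContinuousLinearMap.flip_apply, add_sub_cancel_left, norm_pow, norm_norm]
      using (hφ x hx).norm_sub_sub_le hA hr₁ hI hx hy (hφ (x + h) hy) hm
  exact HasFDerivAt.of_isLittleO <| hquad.trans_isLittleO <|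
    (Asymptotics.isLittleO_norm_pow_id one_lt_two).comp_tendsto
      (tendsto_sub_nhds_zero_iff.2 Filter.tendsto_id)

/-- **Frobenius theorem** for a linear total differential equation `dZ = A Z`. -/
theorem exists_hasFDerivAt_of_isIntegrableAt [CompleteSpace W] {x₀ : E}
    (hA : ContDiffAt ℝ 2 A x₀) (hI : ∀ᶠ y in 𝓝 x₀, IsIntegrableAt A y) (z₀ : W) :
    ∃ Z : E → W, Z x₀ = z₀ ∧ ∀ᶠ x in 𝓝 x₀, HasFDerivAt Z ((A x).flip (Z x)) x := by
  have hA₀ : ContDiffAt ℝ 2 (fun y ↦ A (y + x₀)) 0 :=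
    ContDiffAt.comp 0 (by simpa using hA) (contDiffAt_id.add contDiffAt_const)
  obtain ⟨K, ε, hε, hC⟩ := exists_hasC11Bound hA₀
  obtain ⟨δ, hδ, hIδ⟩ := Metric.eventually_nhds_iff_ball.1 hI
  set ρ : ℝ := 1 / ((K + 1) * (‖z₀‖ + 1)) with hρ
  have hρ₀ : 0 < ρ := by positivity
  set r : ℝ := min (min ε δ) (min 1 ρ)
  have hrδ : r ≤ δ := (min_le_left _ _).trans (min_le_right _ _)
  have hr₀ : 0 < r := lt_min (lt_min hε hδ) (lt_min one_pos hρ₀)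
  have hKr : K * r * (‖z₀‖ + 1) ≤ 1 := by
    have hrρ : r ≤ ρ := (min_le_right _ _).trans (min_le_right _ _)
    calc (K : ℝ) * r * (‖z₀‖ + 1) ≤ (K + 1) * ρ * (‖z₀‖ + 1) := by gcongr; simp
      _ = 1 := by rw [hρ]; field_simp
  have hI₀ : ∀ y ∈ Metric.ball 0 r, IsIntegrableAt (fun y ↦ A (y + x₀)) y := fun y hy ↦ by
    have hy' : y + x₀ ∈ Metric.ball x₀ δ := by
      simpa using (mem_ball_zero_iff.1 hy).trans_le hrδ
    simpa only [IsIntegrableAt, fderiv_comp_add_right] using hIδ _ hy'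
  obtain ⟨Z, hZ₀, hZ⟩ := exists_hasFDerivAt_ball_zero
    (hC.mono ((min_le_left _ _).trans (min_le_left _ _))) hr₀
    ((min_le_right _ _).trans (min_le_left _ _)) hKr hI₀
  refine ⟨fun x ↦ Z (x - x₀), by simpa using hZ₀, ?_⟩
  filter_upwards [Metric.ball_mem_nhds x₀ hr₀] with x hx
  simpa using (hasFDerivAt_comp_sub x₀).2
    (hZ (x - x₀) (mem_ball_zero_iff.2 (mem_ball_iff_norm.1 hx)))

theorem contDiffOn_of_hasFDerivAt_flip {Z : E → W} {s : Set E} {n : ℕ∞} (hs : IsOpen s)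
    (hA : ContDiffOn ℝ n A s) (hZ : ∀ x ∈ s, HasFDerivAt Z ((A x).flip (Z x)) x) :
    ContDiffOn ℝ n Z s := by
  refine contDiffOn_iff_forall_nat_le.2 fun k hk ↦ ?_
  induction k with
  | zero => exact contDiffOn_zero.2 fun x hx ↦ (hZ x hx).continuousAt.continuousWithinAt
  | succ k ih =>
    have hk' : (k : ℕ∞) ≤ n := (Nat.cast_le.2 k.le_succ).trans hk
    rw [Nat.cast_succ]
    refine (contDiffOn_succ_iff_fderiv_of_isOpen hs).2
      ⟨fun x hx ↦ (hZ x hx).differentiableAt.differentiableWithinAt, by simp, ?_⟩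
    have happly : ContDiff ℝ k (ContinuousLinearMap.apply ℝ W : W → (W →L[ℝ] W) →L[ℝ] W) :=
      ContinuousLinearMap.contDiff _
    have hcomp : ContDiffOn ℝ k (fun x ↦ ContinuousLinearMap.apply ℝ W (Z x) ∘L A x) s :=
      (happly.comp_contDiffOn (ih hk')).clm_comp (hA.of_le (by exact_mod_cast hk'))
    exact hcomp.congr fun x hx ↦ (hZ x hx).fderiv

end Frobenius

section FlatCoordinates

attribute [local instance] normedAddCommGroupEnd normedSpaceEnd

variable {E W : Type*} [NormedAddCommGroup E] [NormedSpace ℝ E]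
  [NormedAddCommGroup W] [NormedSpace ℝ W] [CompleteSpace W]
  {Γ : E → E →L[ℝ] E →L[ℝ] E} {s : Set E} {x₀ : E}

theorem exists_parallel_of_antihom {ρ : (E →L[ℝ] E) →L[ℝ] W →L[ℝ] W}
    (hρ : ∀ g h, ρ (g ∘L h) = ρ h ∘L ρ g) (hs : IsOpen s) (hΓ : ContDiffOn ℝ ∞ Γ s)
    (hcurv : ∀ y ∈ s, ∀ a b u, fderiv ℝ Γ y a b u + Γ y a (Γ y b u)
      = fderiv ℝ Γ y b a u + Γ y b (Γ y a u)) (hx₀ : x₀ ∈ s) (z₀ : W) :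
    ∃ Z : E → W, ∃ r > 0, Metric.ball x₀ r ⊆ s ∧ ContDiffOn ℝ ∞ Z (Metric.ball x₀ r) ∧
      Z x₀ = z₀ ∧ ∀ y ∈ Metric.ball x₀ r, ∀ a, fderiv ℝ Z y a = ρ (Γ y a) (Z y) := by
  let P : (E →L[ℝ] E →L[ℝ] E) →L[ℝ] E →L[ℝ] W →L[ℝ] W :=
    ContinuousLinearMap.compL ℝ E (E →L[ℝ] E) (W →L[ℝ] W) ρ
  have hPΓ : ContDiffOn ℝ ∞ (fun y ↦ P (Γ y)) s := P.contDiff.comp_contDiffOn hΓ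
  have hint : ∀ᶠ y in 𝓝 x₀, IsIntegrableAt (fun y ↦ P (Γ y)) y := by
    filter_upwards [hs.mem_nhds hx₀] with y hy a b
    have hΓy := ((hΓ.contDiffAt (hs.mem_nhds hy)).differentiableAt (by simp)).hasFDerivAt
    have hfderiv : fderiv ℝ (fun y ↦ P (Γ y)) y = P ∘L fderiv ℝ Γ y :=
      (P.hasFDerivAt.comp y hΓy).fderiv
    have hcurv' : fderiv ℝ Γ y a b + Γ y a ∘L Γ y b = fderiv ℝ Γ y b a + Γ y b ∘L Γ y a :=
      ContinuousLinearMap.ext (hcurv y hy a b)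
    rw [hfderiv]
    change ρ (fderiv ℝ Γ y a b) + ρ (Γ y b) ∘L ρ (Γ y a)
      = ρ (fderiv ℝ Γ y b a) + ρ (Γ y a) ∘L ρ (Γ y b)
    rw [← hρ, ← hρ, ← map_add, ← map_add, hcurv']
  obtain ⟨Z, hZ₀, hZ⟩ := exists_hasFDerivAt_of_isIntegrableAt
    ((hPΓ.contDiffAt (hs.mem_nhds hx₀)).of_le (by norm_cast)) hint z₀
  obtain ⟨r, hr, hball⟩ := Metric.eventually_nhds_iff_ball.1 (hZ.and (hs.eventually_mem hx₀))
  have hsub : Metric.ball x₀ r ⊆ s := fun y hy ↦ (hball y hy).2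
  refine ⟨Z, r, hr, hsub, contDiffOn_of_hasFDerivAt_flip Metric.isOpen_ball (hPΓ.mono hsub)
    fun y hy ↦ (hball y hy).1, hZ₀, fun y hy a ↦ ?_⟩
  rw [(hball y hy).1.fderiv]
  rfl

theorem exists_parallel_coframe [CompleteSpace E] (hs : IsOpen s) (hΓ : ContDiffOn ℝ ∞ Γ s)
    (hcurv : ∀ y ∈ s, ∀ a b u, fderiv ℝ Γ y a b u + Γ y a (Γ y b u)
      = fderiv ℝ Γ y b a u + Γ y b (Γ y a u)) (hx₀ : x₀ ∈ s) :
    ∃ η : E → E →L[ℝ] E, ∃ r > 0, Metric.ball x₀ r ⊆ s ∧ ContDiffOn ℝ ∞ η (Metric.ball x₀ r) ∧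
      η x₀ = ContinuousLinearMap.id ℝ E ∧
      ∀ y ∈ Metric.ball x₀ r, ∀ a, fderiv ℝ η y a = η y ∘L Γ y a :=
  exists_parallel_of_antihom (ρ := (ContinuousLinearMap.compL ℝ E E E).flip) (fun _ _ ↦ rfl)
    hs hΓ hcurv hx₀ (ContinuousLinearMap.id ℝ E)

theorem exists_affine_coordinates [CompleteSpace E] (hs : IsOpen s) (hΓ : ContDiffOn ℝ ∞ Γ s)
    (hsymm : ∀ y ∈ s, ∀ a u, Γ y a u = Γ y u a)
    (hcurv : ∀ y ∈ s, ∀ a b u, fderiv ℝ Γ y a b u + Γ y a (Γ y b u)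
      = fderiv ℝ Γ y b a u + Γ y b (Γ y a u)) (hx₀ : x₀ ∈ s) :
    ∃ X : E → E, ∃ r > 0, Metric.ball x₀ r ⊆ s ∧ ContDiffOn ℝ ∞ X (Metric.ball x₀ r) ∧
      fderiv ℝ X x₀ = ContinuousLinearMap.id ℝ E ∧
      ∀ y ∈ Metric.ball x₀ r, ∀ a u, fderiv ℝ (fderiv ℝ X) y a u = fderiv ℝ X y (Γ y a u) := by
  obtain ⟨η, r, hr, hsub, hηsmooth, hη₀, hη⟩ := exists_parallel_coframe hs hΓ hcurv hx₀
  obtain ⟨X, hX⟩ := (convex_ball x₀ r).exists_forall_hasFDerivAt_of_fderiv_symmetric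
    Metric.isOpen_ball (hηsmooth.differentiableOn (by simp)) fun y hy a u ↦ by
      rw [hη y hy, hη y hy, ContinuousLinearMap.comp_apply, hsymm y (hsub hy),
        ContinuousLinearMap.comp_apply]
  have hfderiv : EqOn (fderiv ℝ X) η (Metric.ball x₀ r) := fun y hy ↦ (hX y hy).fderiv
  have hXsmooth : ContDiffOn ℝ ∞ X (Metric.ball x₀ r) :=
    (contDiffOn_infty_iff_fderiv_of_isOpen Metric.isOpen_ball).2
      ⟨fun y hy ↦ (hX y hy).differentiableAt.differentiableWithinAt, hηsmooth.congr hfderiv⟩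
  refine ⟨X, r, hr, hsub, hXsmooth, (hfderiv (Metric.mem_ball_self hr)).trans hη₀,
    fun y hy a u ↦ ?_⟩
  rw [(hfderiv.eventuallyEq_of_mem (Metric.isOpen_ball.mem_nhds hy)).fderiv_eq, hfderiv hy,
    hη y hy, ContinuousLinearMap.comp_apply]

end FlatCoordinates

theorem hasFDerivAt_clm_apply_const {E F G : Type*} [NormedAddCommGroup E] [NormedSpace ℝ E]
    [NormedAddCommGroup F] [NormedSpace ℝ F] [NormedAddCommGroup G] [NormedSpace ℝ G]
    {Φ : E → F →L[ℝ] G} {Φ' : E →L[ℝ] F →L[ℝ] G} {y : E} (hΦ : HasFDerivAt Φ Φ' y) (u : F) :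
    HasFDerivAt (fun z ↦ Φ z u) (Φ'.flip u) y :=
  (hΦ.clm_apply (hasFDerivAt_const u y)).congr_fderiv (by ext w; simp)

theorem hasFDerivAt_fderiv {E F : Type*} [NormedAddCommGroup E] [NormedSpace ℝ E]
    [NormedAddCommGroup F] [NormedSpace ℝ F] {φ : E → F} {y : E} (hφ : ContDiffAt ℝ ∞ φ y) :
    HasFDerivAt (fderiv ℝ φ) (fderiv ℝ (fderiv ℝ φ) y) y :=
  ((hφ.fderiv_right (m := 1) (by norm_cast)).differentiableAt one_ne_zero).hasFDerivAt

section Coordinates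

variable {n d : ℕ} {M M' : Type*} [TopologicalSpace M] [ChartedSpace (𝔼 n) M]
  [TopologicalSpace M'] [ChartedSpace (𝔼 d) M'] {f : M → M'} {p : M}
  {x' : OpenPartialHomeomorph M' (𝔼 d)} {c x : OpenPartialHomeomorph M (𝔼 n)}

/-- The derivative of a chart at a point, with values in the model space. It is the inverse of
`v ↦ coordField c v p`. -/
def chartDeriv (c : OpenPartialHomeomorph M (𝔼 n)) (p : M) : TangentSpace (𝓡 n) p →L[ℝ] 𝔼 n :=
  mfderiv (𝓡 n) (𝓡 n) c p

theorem coordField_eq_inverse_chartDeriv (v : 𝔼 n) :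
    coordField c v p = (chartDeriv c p).inverse v :=
  rfl

theorem coordField_eq_sum (v : 𝔼 n) :
    coordField c v p = ∑ i, v i • coordField c (EuclideanSpace.single i 1) p := by
  conv_lhs => rw [← (EuclideanSpace.basisFun (Fin n) ℝ).sum_repr v]
  simp only [coordField_eq_inverse_chartDeriv, map_sum, map_smul,
    EuclideanSpace.basisFun_repr, EuclideanSpace.basisFun_apply]

theorem hasMFDerivAt_chart (hc : c ∈ IsManifold.maximalAtlas (𝓡 n) ∞ M) (hp : p ∈ c.source) :
    HasMFDerivAt (𝓡 n) (𝓡 n) c p (chartDeriv c p) :=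
  ((contMDiffAt_of_mem_maximalAtlas hc hp).mdifferentiableAt (by simp)).hasMFDerivAt

theorem isInvertible_chartDeriv (hc : c ∈ IsManifold.maximalAtlas (𝓡 n) ∞ M)
    (hp : p ∈ c.source) : (chartDeriv c p).IsInvertible :=
  ⟨OpenPartialHomeomorph.MDifferentiable.mfderiv
    ⟨(contMDiffOn_of_mem_maximalAtlas hc).mdifferentiableOn (by simp),
      (contMDiffOn_symm_of_mem_maximalAtlas hc).mdifferentiableOn (by simp)⟩ hp, rfl⟩

theorem chartDeriv_coordField (hc : c ∈ IsManifold.maximalAtlas (𝓡 n) ∞ M) (hp : p ∈ c.source)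
    (v : 𝔼 n) : chartDeriv c p (coordField c v p) = v :=
  (isInvertible_chartDeriv hc hp).self_apply_inverse v

theorem coordField_chartDeriv (hc : c ∈ IsManifold.maximalAtlas (𝓡 n) ∞ M) (hp : p ∈ c.source)
    (v : TangentSpace (𝓡 n) p) : coordField c (chartDeriv c p v) p = v :=
  (isInvertible_chartDeriv hc hp).inverse_apply_self v

/-- The expression of `f` in the charts `c` and `c'`. -/
def inCharts (f : M → M') (c : OpenPartialHomeomorph M (𝔼 n))
    (c' : OpenPartialHomeomorph M' (𝔼 d)) : 𝔼 n → 𝔼 d :=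
  c' ∘ f ∘ c.symm

theorem contDiffAt_inCharts (hf : ContMDiffAt (𝓡 n) (𝓡 d) ∞ f p)
    (hc : c ∈ IsManifold.maximalAtlas (𝓡 n) ∞ M) (hx' : x' ∈ IsManifold.maximalAtlas (𝓡 d) ∞ M')
    (hpc : p ∈ c.source) (hpx' : f p ∈ x'.source) : ContDiffAt ℝ ∞ (inCharts f c x') (c p) := by
  refine ContMDiffAt.contDiffAt (ContMDiffAt.comp (I' := 𝓡 n) (c p) (g := x' ∘ f) ?_
    (contMDiffAt_symm_of_mem_maximalAtlas hc (c.map_source hpc)))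
  rw [c.left_inv hpc]
  exact (contMDiffAt_of_mem_maximalAtlas hx' hpx').comp p hf

theorem chartDeriv_mfderiv (hf : ContMDiffAt (𝓡 n) (𝓡 d) ∞ f p)
    (hc : c ∈ IsManifold.maximalAtlas (𝓡 n) ∞ M) (hx' : x' ∈ IsManifold.maximalAtlas (𝓡 d) ∞ M')
    (hpc : p ∈ c.source) (hpx' : f p ∈ x'.source) (v : TangentSpace (𝓡 n) p) :
    chartDeriv x' (f p) (mfderiv (𝓡 n) (𝓡 d) f p v)
      = fderiv ℝ (inCharts f c x') (c p) (chartDeriv c p v) := by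
  have hφ : HasMFDerivAt (𝓡 n) (𝓡 d) (inCharts f c x') (c p)
      (fderiv ℝ (inCharts f c x') (c p)) :=
    ((contDiffAt_inCharts hf hc hx' hpc hpx').differentiableAt
      (by simp)).hasFDerivAt.hasMFDerivAt
  have heq : x' ∘ f =ᶠ[𝓝 p] inCharts f c x' ∘ c := by
    filter_upwards [c.open_source.mem_nhds hpc] with q hq
    simp [inCharts, c.left_inv hq]
  exact congrArg (· v) (hasMFDerivAt_unique
    ((hasMFDerivAt_chart hx' hpx').comp p (hf.mdifferentiableAt (by simp)).hasMFDerivAt)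
    ((hφ.comp p (hasMFDerivAt_chart hc hpc)).congr_of_eventuallyEq heq))

theorem contDiffAt_chart_change (hc : c ∈ IsManifold.maximalAtlas (𝓡 n) ∞ M)
    (hx : x ∈ IsManifold.maximalAtlas (𝓡 n) ∞ M) (hpc : p ∈ c.source) (hpx : p ∈ x.source) :
    ContDiffAt ℝ ∞ (x ∘ c.symm) (c p) :=
  contDiffAt_inCharts (f := id) contMDiffAt_id hc hx hpc hpx

theorem chartDeriv_eq_fderiv_chart_change (hc : c ∈ IsManifold.maximalAtlas (𝓡 n) ∞ M)
    (hx : x ∈ IsManifold.maximalAtlas (𝓡 n) ∞ M) (hpc : p ∈ c.source) (hpx : p ∈ x.source)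
    (v : TangentSpace (𝓡 n) p) :
    chartDeriv x p v = fderiv ℝ (x ∘ c.symm) (c p) (chartDeriv c p v) := by
  have h := chartDeriv_mfderiv (f := id) contMDiffAt_id hc hx hpc hpx v
  rwa [mfderiv_id] at h

theorem coordField_chart_change (hc : c ∈ IsManifold.maximalAtlas (𝓡 n) ∞ M)
    (hx : x ∈ IsManifold.maximalAtlas (𝓡 n) ∞ M) (hpc : p ∈ c.source) (hpx : p ∈ x.source)
    (u : 𝔼 n) : coordField x (fderiv ℝ (x ∘ c.symm) (c p) u) p = coordField c u p := by
  rw [← coordField_chartDeriv hx hpx (coordField c u p),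
    chartDeriv_eq_fderiv_chart_change hc hx hpc hpx, chartDeriv_coordField hc hpc]

variable [IsManifold (𝓡 n) ∞ M]

theorem contMDiffAt_coordField (hc : c ∈ IsManifold.maximalAtlas (𝓡 n) ∞ M) (hp : p ∈ c.source)
    (v : 𝔼 n) : ContMDiffAt (𝓡 n) (𝓡 n).tangent ∞ (T% (coordField c v)) p :=
  ContMDiffAt.mpullback_vectorField_preimage (n := ∞) (V := fun _ ↦ v)
    (contMDiffAt_vectorSpace_iff_contDiffAt.2 contDiffAt_const)
    (contMDiffAt_of_mem_maximalAtlas hc hp) (isInvertible_chartDeriv hc hp) (by simp)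

theorem mdifferentiableAt_coordField (hc : c ∈ IsManifold.maximalAtlas (𝓡 n) ∞ M)
    (hp : p ∈ c.source) (v : 𝔼 n) :
    MDifferentiableAt (𝓡 n) (𝓡 n).tangent (T% (coordField c v)) p :=
  (contMDiffAt_coordField hc hp v).mdifferentiableAt (by simp)

section Connection

variable (D : Connection n M)

theorem connection_sum {ι : Type*} (s : Finset ι) (σ : ι → ∀ q : M, TangentSpace (𝓡 n) q)
    (hσ : ∀ i ∈ s, MDifferentiableAt (𝓡 n) (𝓡 n).tangent (T% (σ i)) p) :
    D (∑ i ∈ s, σ i) p = ∑ i ∈ s, D (σ i) p := by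
  classical
  induction s using Finset.induction_on with
  | empty => simp
  | insert a s ha ih =>
    have hs : ∀ i ∈ s, MDifferentiableAt (𝓡 n) (𝓡 n).tangent (T% (σ i)) p :=
      fun i hi ↦ hσ i (Finset.mem_insert_of_mem hi)
    have hsum : MDifferentiableAt (𝓡 n) (𝓡 n).tangent (T% (∑ i ∈ s, σ i)) p := by
      convert! MDifferentiableAt.sum_section hs using 3
      simp
    rw [Finset.sum_insert ha, Finset.sum_insert ha, ← ih hs]
    exact D.isCovariantDerivativeOnUniv.add (hσ a (Finset.mem_insert_self a s)) hsum

theorem connection_congr {D : Connection n M} {σ τ : ∀ q : M, TangentSpace (𝓡 n) q}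
    (hσ : MDifferentiableAt (𝓡 n) (𝓡 n).tangent (T% σ) p)
    (h : ∀ᶠ q in 𝓝 p, σ q = τ q) : D σ p = D τ p := by
  refine D.isCovariantDerivativeOnUniv.congr_of_eventuallyEq hσ
    (hσ.congr_of_eventuallyEq ?_) Filter.univ_mem h
  filter_upwards [h] with q hq
  rw [hq]

theorem connection_coordField_comp_eq_sum_add (hc : c ∈ IsManifold.maximalAtlas (𝓡 n) ∞ M)
    (hp : p ∈ c.source) {G : M → 𝔼 n} {G' : TangentSpace (𝓡 n) p →L[ℝ] 𝔼 n}
    (hG : HasMFDerivAt (𝓡 n) 𝓘(ℝ, 𝔼 n) G p G') (v : TangentSpace (𝓡 n) p) :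
    D (fun q ↦ coordField c (G q) q) p v
      = ∑ i, G p i • D (coordField c (EuclideanSpace.single i 1)) p v
        + coordField c (G' v) p := by
  have hsum : (fun q ↦ coordField c (G q) q)
      = ∑ i, (fun q ↦ G q i) • coordField c (EuclideanSpace.single i (1 : ℝ)) := by
    funext q
    rw [coordField_eq_sum]
    simp
  have hGi : ∀ i, HasMFDerivAt (𝓡 n) 𝓘(ℝ, ℝ) (fun q ↦ G q i) p
      ((EuclideanSpace.proj i : 𝔼 n →L[ℝ] ℝ).comp G') := fun i ↦
    (EuclideanSpace.proj i : 𝔼 n →L[ℝ] ℝ).hasMFDerivAt.comp p hG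
  have hframe := fun i ↦ mdifferentiableAt_coordField hc hp (EuclideanSpace.single i (1 : ℝ))
  rw [hsum, connection_sum D Finset.univ _ fun i _ ↦
    (hGi i).mdifferentiableAt.smul_section (hframe i), coordField_eq_sum (G' v),
    ← Finset.sum_add_distrib, sum_apply]
  refine Finset.sum_congr rfl fun i _ ↦ ?_
  have hG'i : mvfderiv (𝓡 n) (fun q ↦ G q i) p v = G' v i := by
    rw [mvfderiv, (hGi i).mfderiv]
    rfl
  rw [D.isCovariantDerivativeOnUniv.leibniz (hframe i) (hGi i).mdifferentiableAt, ← hG'i]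
  rfl

theorem connection_coordField_eq_sum (hc : c ∈ IsManifold.maximalAtlas (𝓡 n) ∞ M)
    (hp : p ∈ c.source) (u : 𝔼 n) (v : TangentSpace (𝓡 n) p) :
    D (coordField c u) p v
      = ∑ i, u i • D (coordField c (EuclideanSpace.single i 1)) p v := by
  refine (connection_coordField_comp_eq_sum_add D hc hp (hasMFDerivAt_const u p) v).trans ?_
  exact (congrArg _ (map_zero (chartDeriv c p).inverse)).trans (add_zero _)

theorem connection_coordField_comp (hc : c ∈ IsManifold.maximalAtlas (𝓡 n) ∞ M)
    (hp : p ∈ c.source) {G : M → 𝔼 n} {G' : TangentSpace (𝓡 n) p →L[ℝ] 𝔼 n}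
    (hG : HasMFDerivAt (𝓡 n) 𝓘(ℝ, 𝔼 n) G p G') (v : TangentSpace (𝓡 n) p) :
    D (fun q ↦ coordField c (G q) q) p v
      = D (coordField c (G p)) p v + coordField c (G' v) p := by
  rw [connection_coordField_comp_eq_sum_add D hc hp hG,
    connection_coordField_eq_sum D hc hp (G p)]

/-- The Christoffel symbols of a connection in the chart `c`, as a bilinear map:
`christoffel D c y a u` is the expression in `c` of `∇_a u` at the point of coordinates `y`, for
`a` and `u` constant in the chart. The sum over a basis makes it continuous and bilinear also
where `c` is not a chart of the smooth structure. -/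
def christoffel (c : OpenPartialHomeomorph M (𝔼 n)) (y : 𝔼 n) : 𝔼 n →L[ℝ] 𝔼 n →L[ℝ] 𝔼 n :=
  ∑ j, (ContinuousLinearMap.smulRightL ℝ (𝔼 n) (𝔼 n) (EuclideanSpace.proj j)).comp
    ((chartDeriv c (c.symm y)).comp
      ((D (coordField c (EuclideanSpace.single j 1)) (c.symm y)).comp
        (chartDeriv c (c.symm y)).inverse))

theorem christoffel_apply (hc : c ∈ IsManifold.maximalAtlas (𝓡 n) ∞ M) (hp : p ∈ c.source)
    (a u : 𝔼 n) :
    christoffel D c (c p) a u = chartDeriv c p (D (coordField c u) p (coordField c a p)) := by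
  rw [connection_coordField_eq_sum D hc hp, map_sum, christoffel, sum_apply, sum_apply,
    c.left_inv hp]
  simp only [map_smul]
  rfl

theorem connection_coordField_eq_christoffel (hc : c ∈ IsManifold.maximalAtlas (𝓡 n) ∞ M)
    (hp : p ∈ c.source) (u : 𝔼 n) (v : TangentSpace (𝓡 n) p) :
    D (coordField c u) p v
      = coordField c (christoffel D c (c p) (chartDeriv c p v) u) p := by
  rw [christoffel_apply D hc hp, coordField_chartDeriv hc hp, coordField_chartDeriv hc hp]

end Connection

theorem connection_chart_change (D : Connection n M)
    (hc : c ∈ IsManifold.maximalAtlas (𝓡 n) ∞ M) (hx : x ∈ IsManifold.maximalAtlas (𝓡 n) ∞ M)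
    (hpc : p ∈ c.source) (hpx : p ∈ x.source) (u : 𝔼 n) (v : TangentSpace (𝓡 n) p) :
    D (coordField c u) p v = D (coordField x (fderiv ℝ (x ∘ c.symm) (c p) u)) p v
      + coordField x (fderiv ℝ (fderiv ℝ (x ∘ c.symm)) (c p) (chartDeriv c p v) u) p := by
  have hcoeff := (hasFDerivAt_clm_apply_const (hasFDerivAt_fderiv
    (contDiffAt_chart_change hc hx hpc hpx)) u).hasMFDerivAt.comp p (hasMFDerivAt_chart hc hpc)
  have heq : ∀ᶠ q in 𝓝 p, coordField c u q
      = coordField x (fderiv ℝ (x ∘ c.symm) (c q) u) q := by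
    filter_upwards [c.open_source.mem_nhds hpc, x.open_source.mem_nhds hpx] with q hqc hqx
    rw [coordField_chart_change hc hx hqc hqx]
  rw [connection_congr (mdifferentiableAt_coordField hc hpc u) heq]
  exact connection_coordField_comp D hx hpx hcoeff v

end Coordinates

section FlatConnection

attribute [local instance] normedAddCommGroupEnd normedSpaceEnd

variable {n : ℕ} {M : Type*} [TopologicalSpace M] [ChartedSpace (𝔼 n) M] [IsManifold (𝓡 n) ∞ M]
  {c : OpenPartialHomeomorph M (𝔼 n)} {p : M} {D : Connection n M}

theorem exists_isSmoothField_eventuallyEq_coordField [T2Space M]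
    (hc : c ∈ IsManifold.maximalAtlas (𝓡 n) ∞ M) (hp : p ∈ c.source) (v : 𝔼 n) :
    ∃ X : ∀ q : M, TangentSpace (𝓡 n) q, IsSmoothField X ∧ ∀ᶠ q in 𝓝 p, X q = coordField c v q := by
  obtain ⟨ρ, -, hρ⟩ := (SmoothBumpFunction.nhds_basis_tsupport (I := 𝓡 n) p).mem_iff.1
    (c.open_source.mem_nhds hp)
  refine ⟨(ρ : M → ℝ) • coordField c v,
    ContMDiffOn.smul_section_of_tsupport (n := ∞) ρ.contMDiff.contMDiffOn c.open_source hρ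
      fun q hq ↦ (contMDiffAt_coordField hc hq v).contMDiffWithinAt, ?_⟩
  filter_upwards [ρ.eventuallyEq_one] with q hq
  change ρ q • coordField c v q = _
  rw [hq]
  exact one_smul ℝ _

theorem contMDiffAt_chartDeriv_apply (hc : c ∈ IsManifold.maximalAtlas (𝓡 n) ∞ M)
    (hp : p ∈ c.source) {σ : ∀ q : M, TangentSpace (𝓡 n) q}
    (hσ : ContMDiffAt (𝓡 n) (𝓡 n).tangent ∞ (T% σ) p) :
    ContMDiffAt (𝓡 n) 𝓘(ℝ, 𝔼 n) ∞ (fun q ↦ chartDeriv c q (σ q)) p := by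
  have htangent : ContMDiffAt (𝓡 n).tangent (𝓡 n).tangent ∞
      (tangentMapWithin (𝓡 n) (𝓡 n) c c.source) ⟨p, σ p⟩ :=
    ((contMDiffOn_of_mem_maximalAtlas hc).contMDiffOn_tangentMapWithin (m := ∞) (by simp)
      c.open_source.uniqueMDiffOn).contMDiffAt
      ((c.open_source.preimage (FiberBundle.continuous_proj _ _)).mem_nhds hp)
  refine ((contMDiff_snd_tangentBundle_modelSpace (𝔼 n) (𝓡 n)).contMDiffAt.comp p
    (htangent.comp p hσ)).congr_of_eventuallyEq ?_
  filter_upwards [c.open_source.mem_nhds hp] with q hq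
  change mfderiv (𝓡 n) (𝓡 n) c q (σ q) = mfderivWithin (𝓡 n) (𝓡 n) c c.source q (σ q)
  rw [mfderivWithin_of_isOpen c.open_source hq]

theorem contMDiffAt_connection_coordField [T2Space M] (hD : D.ContMDiffCovariantDerivative ∞)
    (hc : c ∈ IsManifold.maximalAtlas (𝓡 n) ∞ M) (hp : p ∈ c.source) (a u : 𝔼 n) :
    ContMDiffAt (𝓡 n) (𝓡 n).tangent ∞
      (T% (fun q ↦ D (coordField c u) q (coordField c a q))) p := by
  obtain ⟨X, hX, hXu⟩ := exists_isSmoothField_eventuallyEq_coordField hc hp u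
  have hDX := hD.contMDiff.contMDiff (σ := X) (ContMDiff.contMDiffOn (s := univ) hX)
  refine (((hDX p (mem_univ p)).contMDiffAt Filter.univ_mem).clm_bundle_apply
    (contMDiffAt_coordField hc hp a)).congr_of_eventuallyEq ?_
  filter_upwards [hXu.eventually_nhds] with q hq
  rw [connection_congr (hX.mdifferentiableAt (by simp)) hq]

theorem contDiffOn_christoffel [T2Space M] (hD : D.ContMDiffCovariantDerivative ∞)
    (hc : c ∈ IsManifold.maximalAtlas (𝓡 n) ∞ M) :
    ContDiffOn ℝ ∞ (christoffel D c) c.target := by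
  refine contDiffOn_clm_apply.2 fun a ↦ contDiffOn_clm_apply.2 fun u ↦ fun y hy ↦ ?_
  have hp := c.map_target hy
  have hsmooth := (contMDiffAt_chartDeriv_apply hc hp
    (contMDiffAt_connection_coordField hD hc hp a u)).comp y
    (contMDiffAt_symm_of_mem_maximalAtlas hc hy)
  refine (hsmooth.congr_of_eventuallyEq ?_).contDiffAt.contDiffWithinAt
  filter_upwards [c.open_target.mem_nhds hy] with z hz
  simp only [Function.comp_apply]
  rw [← christoffel_apply D hc (c.map_target hz), c.right_inv hz]

theorem mlieBracket_coordField (hc : c ∈ IsManifold.maximalAtlas (𝓡 n) ∞ M) (hp : p ∈ c.source)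
    (a b : 𝔼 n) : VectorField.mlieBracket (𝓡 n) (coordField c a) (coordField c b) p = 0 := by
  have hconst : ∀ v : 𝔼 n, MDifferentiableAt (𝓡 n) (𝓡 n).tangent
      (fun y ↦ (⟨y, v⟩ : TangentBundle (𝓡 n) (𝔼 n))) (c p) := fun v ↦
    (contMDiffAt_vectorSpace_iff_contDiffAt (n := 1) (V := fun _ ↦ v).2
      contDiffAt_const).mdifferentiableAt (by simp)
  have htwo : minSmoothness ℝ 2 ≤ ∞ := by
    rw [minSmoothness_of_isRCLikeNormedField]
    exact WithTop.coe_le_coe.2 le_top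
  have : IsManifold (𝓡 n) (minSmoothness ℝ 2) M := IsManifold.of_le htwo
  have hbracket : VectorField.mlieBracket (𝓡 n) (fun _ : 𝔼 n ↦ a) (fun _ ↦ b) (c p) = 0 :=
    (congrFun (VectorField.mlieBracketWithin_eq_lieBracketWithin (s := univ)) (c p)).trans
      (by simp [VectorField.lieBracketWithin]; rfl)
  refine (VectorField.mpullback_mlieBracket (I' := 𝓡 n) (n := ∞) (f := c) (V := fun _ ↦ a)
    (W := fun _ ↦ b) (hconst a) (hconst b) (contMDiffAt_of_mem_maximalAtlas hc hp)
    htwo).symm.trans ?_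
  exact (congrArg (chartDeriv c p).inverse hbracket).trans (map_zero _)

theorem IsFlat.christoffel_symm (hflat : IsFlat D) (hc : c ∈ IsManifold.maximalAtlas (𝓡 n) ∞ M)
    (hp : p ∈ c.source) (a b : 𝔼 n) :
    christoffel D c (c p) a b = christoffel D c (c p) b a := by
  have htorsion := D.torsion_apply (mdifferentiableAt_coordField hc hp a)
    (mdifferentiableAt_coordField hc hp b)
  rw [hflat.torsion_eq_zero, mlieBracket_coordField hc hp, sub_zero] at htorsion
  rw [christoffel_apply D hc hp, christoffel_apply D hc hp, sub_eq_zero.1 htorsion.symm]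

theorem connection_connection_coordField [T2Space M] (hD : D.ContMDiffCovariantDerivative ∞)
    (hc : c ∈ IsManifold.maximalAtlas (𝓡 n) ∞ M) (hp : p ∈ c.source) (a b u : 𝔼 n) :
    D (fun q ↦ D (coordField c u) q (coordField c b q)) p (coordField c a p)
      = coordField c (fderiv ℝ (christoffel D c) (c p) a b u
          + christoffel D c (c p) a (christoffel D c (c p) b u)) p := by
  have heq : ∀ᶠ q in 𝓝 p, D (coordField c u) q (coordField c b q)
      = coordField c (christoffel D c (c q) b u) q := by
    filter_upwards [c.open_source.mem_nhds hp] with q hq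
    rw [connection_coordField_eq_christoffel D hc hq, chartDeriv_coordField hc hq]
  have hΓ := (((contDiffOn_christoffel hD hc).contDiffAt
    (c.open_target.mem_nhds (c.map_source hp))).differentiableAt (by simp)).hasFDerivAt
  rw [connection_congr
    ((contMDiffAt_connection_coordField hD hc hp b u).mdifferentiableAt (by simp)) heq]
  refine (connection_coordField_comp D hc hp
    ((hasFDerivAt_clm_apply_const (hasFDerivAt_clm_apply_const hΓ b) u).hasMFDerivAt.comp p
      (hasMFDerivAt_chart hc hp)) (coordField c a p)).trans ?_
  change D (coordField c (christoffel D c (c p) b u)) p (coordField c a p)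
    + coordField c (fderiv ℝ (christoffel D c) (c p) (chartDeriv c p (coordField c a p)) b u) p = _
  rw [connection_coordField_eq_christoffel D hc hp, chartDeriv_coordField hc hp, add_comm]
  exact (map_add (chartDeriv c p).inverse _ _).symm

theorem nabla_nabla_of_eventuallyEq_coordField [T2Space M]
    (hD : D.ContMDiffCovariantDerivative ∞) (hc : c ∈ IsManifold.maximalAtlas (𝓡 n) ∞ M)
    (hp : p ∈ c.source) {X Y Z : ∀ q : M, TangentSpace (𝓡 n) q} (hZ : IsSmoothField Z)
    {a b u : 𝔼 n} (hXa : ∀ᶠ q in 𝓝 p, X q = coordField c a q)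
    (hYb : ∀ᶠ q in 𝓝 p, Y q = coordField c b q) (hZu : ∀ᶠ q in 𝓝 p, Z q = coordField c u q) :
    nabla D X (nabla D Y Z) p = coordField c (fderiv ℝ (christoffel D c) (c p) a b u
          + christoffel D c (c p) a (christoffel D c (c p) b u)) p := by
  have heq : ∀ᶠ q in 𝓝 p, D (coordField c u) q (coordField c b q) = nabla D Y Z q := by
    filter_upwards [hYb, hZu.eventually_nhds] with q hqY hqZ
    rw [nabla, hqY, connection_congr (hZ.mdifferentiableAt (by simp)) hqZ]
  rw [← connection_connection_coordField hD hc hp, connection_congr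
    ((contMDiffAt_connection_coordField hD hc hp b u).mdifferentiableAt (by simp)) heq, nabla,
    hXa.self_of_nhds]

theorem IsFlat.christoffel_curvature [T2Space M] (hflat : IsFlat D)
    (hD : D.ContMDiffCovariantDerivative ∞) (hc : c ∈ IsManifold.maximalAtlas (𝓡 n) ∞ M)
    (hp : p ∈ c.source) (a b u : 𝔼 n) :
    fderiv ℝ (christoffel D c) (c p) a b u
        + christoffel D c (c p) a (christoffel D c (c p) b u)
      = fderiv ℝ (christoffel D c) (c p) b a u
        + christoffel D c (c p) b (christoffel D c (c p) a u) := by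
  obtain ⟨X, hX, hXa⟩ := exists_isSmoothField_eventuallyEq_coordField hc hp a
  obtain ⟨Y, hY, hYb⟩ := exists_isSmoothField_eventuallyEq_coordField hc hp b
  obtain ⟨Z, hZ, hZu⟩ := exists_isSmoothField_eventuallyEq_coordField hc hp u
  have hbracket : VectorField.mlieBracket (𝓡 n) X Y p = 0 := by
    rw [Filter.EventuallyEq.mlieBracket_vectorField_eq hXa hYb, mlieBracket_coordField hc hp]
  have hcurv := hflat.curvature_eq_zero X Y Z hX hY hZ p
  rw [curvature, nabla_nabla_of_eventuallyEq_coordField hD hc hp hZ hXa hYb hZu,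
    nabla_nabla_of_eventuallyEq_coordField hD hc hp hZ hYb hXa hZu, nabla, hbracket, map_zero,
    sub_zero, sub_eq_zero] at hcurv
  simpa only [chartDeriv_coordField hc hp] using congrArg (chartDeriv c p) hcurv

end FlatConnection

theorem exists_openPartialHomeomorph_of_contDiffOn {E : Type*} [NormedAddCommGroup E]
    [NormedSpace ℝ E] [CompleteSpace E] {X : E → E} {U : Set E} (hU : IsOpen U)
    (hX : ContDiffOn ℝ ∞ X U) {x₀ : E} (hx₀ : x₀ ∈ U) (hX' : (fderiv ℝ X x₀).IsInvertible) :
    ∃ e : OpenPartialHomeomorph E E, x₀ ∈ e.source ∧ e.source ⊆ U ∧ (e : E → E) = X ∧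
      ContDiffOn ℝ ∞ e.symm e.target := by
  have hXat : ∀ y ∈ U, ContDiffAt ℝ ∞ X y := fun y hy ↦ hX.contDiffAt (hU.mem_nhds hy)
  have hder : ∀ y ∈ U, ∀ L : E ≃L[ℝ] E, L = fderiv ℝ X y → HasFDerivAt X (L : E →L[ℝ] E) y :=
    fun y hy L hL ↦ hL ▸ ((hXat y hy).differentiableAt (by simp)).hasFDerivAt
  obtain ⟨L₀, hL₀⟩ := hX'
  let e₀ := (hXat x₀ hx₀).toOpenPartialHomeomorph X (hder x₀ hx₀ L₀ hL₀) (by simp)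
  have hV : IsOpen (U ∩ fderiv ℝ X ⁻¹' range ((↑) : (E ≃L[ℝ] E) → E →L[ℝ] E)) :=
    (hX.continuousOn_fderiv_of_isOpen hU (by simp)).isOpen_inter_preimage hU
      ContinuousLinearEquiv.isOpen
  let e := e₀.restrOpen _ hV
  refine ⟨e, ⟨(hXat x₀ hx₀).mem_toOpenPartialHomeomorph_source (hder x₀ hx₀ L₀ hL₀) (by simp),
    hx₀, L₀, hL₀⟩, fun y hy ↦ hy.2.1, rfl, fun z hz ↦ ?_⟩
  obtain ⟨-, hU', L, hL⟩ := e.map_target hz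
  exact (e.contDiffAt_symm hz (hder _ hU' L hL) (hXat _ hU')).contDiffWithinAt

section AffineChart

variable {n : ℕ} {M : Type*} [TopologicalSpace M] [ChartedSpace (𝔼 n) M]
  [IsManifold (𝓡 n) ∞ M] {c x : OpenPartialHomeomorph M (𝔼 n)} {p : M} {D : Connection n M}

theorem IsAffineChart.connection_coordField_eq_zero (hx : IsAffineChart D x) (hp : p ∈ x.source)
    (u : 𝔼 n) : D (coordField x u) p = 0 := by
  ext1 v
  rw [connection_coordField_eq_sum D hx.mem_maximalAtlas hp, zero_apply]
  refine Finset.sum_eq_zero fun j _ ↦ ?_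
  rw [← coordField_chartDeriv hx.mem_maximalAtlas hp v, coordField_eq_sum, map_sum]
  refine smul_eq_zero_of_right _ (Finset.sum_eq_zero fun i _ ↦ ?_)
  rw [map_smul]
  exact smul_eq_zero_of_right _ (hx.nabla_eq_zero i j p hp)

theorem isAffineChart_of_connection_eq_zero (hx : x ∈ IsManifold.maximalAtlas (𝓡 n) ∞ M)
    (h : ∀ p ∈ x.source, ∀ u, D (coordField x u) p = 0) : IsAffineChart D x :=
  ⟨hx, fun i j p hp ↦ by rw [nabla, h p hp, zero_apply]⟩

theorem IsAffineChart.restrOpen_target (hx : IsAffineChart D x) {s : Set (𝔼 n)} (hs : IsOpen s) :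
    IsAffineChart D (x.symm.restrOpen s hs).symm := by
  refine ⟨(x.symm.restrOpen s hs).symm.mem_maximalAtlas_of_contMDiffOn ?_ ?_,
    fun i j p hp ↦ hx.nabla_eq_zero i j p hp.1⟩
  · exact (contMDiffOn_of_mem_maximalAtlas hx.mem_maximalAtlas).mono inter_subset_left
  · exact (contMDiffOn_symm_of_mem_maximalAtlas hx.mem_maximalAtlas).mono inter_subset_left

theorem trans_mem_maximalAtlas (hc : c ∈ IsManifold.maximalAtlas (𝓡 n) ∞ M)
    {e : OpenPartialHomeomorph (𝔼 n) (𝔼 n)} (he : ContDiffOn ℝ ∞ e e.source)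
    (he' : ContDiffOn ℝ ∞ e.symm e.target) : c.trans e ∈ IsManifold.maximalAtlas (𝓡 n) ∞ M := by
  refine (c.trans e).mem_maximalAtlas_of_contMDiffOn ?_ ?_
  · rw [OpenPartialHomeomorph.trans_source, OpenPartialHomeomorph.coe_trans]
    exact he.contMDiffOn.comp' (contMDiffOn_of_mem_maximalAtlas hc)
  · rw [OpenPartialHomeomorph.trans_target, OpenPartialHomeomorph.coe_trans_symm]
    exact (contMDiffOn_symm_of_mem_maximalAtlas hc).comp' he'.contMDiffOn

theorem connection_coordField_eq_zero_of_fderiv_fderiv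
    (hc : c ∈ IsManifold.maximalAtlas (𝓡 n) ∞ M) (hx : x ∈ IsManifold.maximalAtlas (𝓡 n) ∞ M)
    (hpc : p ∈ c.source) (hpx : p ∈ x.source)
    (hpde : ∀ a u, fderiv ℝ (fderiv ℝ (x ∘ c.symm)) (c p) a u
      = fderiv ℝ (x ∘ c.symm) (c p) (christoffel D c (c p) a u)) (w : 𝔼 n) :
    D (coordField x w) p = 0 := by
  obtain ⟨u, rfl⟩ : ∃ u, fderiv ℝ (x ∘ c.symm) (c p) u = w :=
    ⟨chartDeriv c p (coordField x w p), by
      rw [← chartDeriv_eq_fderiv_chart_change hc hx hpc hpx, chartDeriv_coordField hx hpx]⟩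
  ext1 v
  have h := connection_chart_change D hc hx hpc hpx u v
  rw [hpde, coordField_chart_change hc hx hpc hpx,
    ← connection_coordField_eq_christoffel D hc hpc] at h
  exact right_eq_add.1 h

theorem exists_isAffineChart [T2Space M] (hD : D.ContMDiffCovariantDerivative ∞)
    (hflat : IsFlat D) (p : M) : ∃ x, IsAffineChart D x ∧ p ∈ x.source := by
  set c := chartAt (𝔼 n) p
  have hc : c ∈ IsManifold.maximalAtlas (𝓡 n) ∞ M := IsManifold.chart_mem_maximalAtlas p
  have hp : p ∈ c.source := mem_chart_source _ p
  obtain ⟨X, r, hr, -, hX, hX0, hXpde⟩ := exists_affine_coordinates c.open_target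
    (contDiffOn_christoffel hD hc)
    (fun y hy ↦ c.right_inv hy ▸ hflat.christoffel_symm hc (c.map_target hy))
    (fun y hy ↦ c.right_inv hy ▸ hflat.christoffel_curvature hD hc (c.map_target hy))
    (c.map_source hp)
  obtain ⟨e, hpe, her, heX, he'⟩ := exists_openPartialHomeomorph_of_contDiffOn
    Metric.isOpen_ball hX (Metric.mem_ball_self hr) (hX0 ▸ ⟨.refl ℝ _, rfl⟩)
  have hx := trans_mem_maximalAtlas hc (heX ▸ hX.mono her) he'
  refine ⟨c.trans e, isAffineChart_of_connection_eq_zero hx fun q hq w ↦ ?_, hp, hpe⟩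
  have hψ : c.trans e ∘ c.symm =ᶠ[𝓝 (c q)] X := by
    filter_upwards [c.open_target.mem_nhds (c.map_source hq.1)] with y hy
    simp [c.right_inv hy, heX]
  refine connection_coordField_eq_zero_of_fderiv_fderiv hc hx hq.1 hq (fun a u ↦ ?_) w
  rw [hψ.fderiv_eq, hψ.fderiv.fderiv_eq]
  exact hXpde _ (her hq.2) a u

theorem exists_isAffineChart_subset [T2Space M] (hD : D.ContMDiffCovariantDerivative ∞)
    (hflat : IsFlat D) {U : Set M} (hU : IsOpen U) (hp : p ∈ U) :
    ∃ x, IsAffineChart D x ∧ p ∈ x.source ∧ x.source ⊆ U ∧ IsPreconnected x.target := by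
  obtain ⟨x, hx, hpx⟩ := exists_isAffineChart hD hflat p
  obtain ⟨r, hr, hball⟩ := Metric.isOpen_iff.1 (x.isOpen_inter_preimage_symm hU) (x p)
    ⟨x.map_source hpx, by rwa [mem_preimage, x.left_inv hpx]⟩
  have htarget : (x.symm.restrOpen _ Metric.isOpen_ball).symm.target = Metric.ball (x p) r :=
    inter_eq_right.2 (hball.trans inter_subset_left)
  refine ⟨_, hx.restrOpen_target (s := Metric.ball (x p) r) Metric.isOpen_ball,
    ⟨hpx, Metric.mem_ball_self hr⟩, fun q hq ↦ x.left_inv hq.1 ▸ (hball hq.2).2, ?_⟩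
  rw [htarget]
  exact (convex_ball _ _).isPreconnected

end AffineChart

section TangentChart

variable {n d : ℕ} {M M' : Type*} [TopologicalSpace M] [ChartedSpace (𝔼 n) M]
  [TopologicalSpace M'] [ChartedSpace (𝔼 d) M'] {f : M → M'} {u : TangentBundle (𝓡 n) M}
  {x' : OpenPartialHomeomorph M' (𝔼 d)} {x : OpenPartialHomeomorph M (𝔼 n)}

/-- The coordinates `(q, r)` on `TM` induced by a chart of `M`: the coordinates of the base point
and the components of the tangent vector. -/
def tangentChart (x : OpenPartialHomeomorph M (𝔼 n)) (u : TangentBundle (𝓡 n) M) : 𝔼 n × 𝔼 n :=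
  (x u.proj, chartDeriv x u.proj u.snd)

theorem hasFDerivAt_fderiv_uncurry {E F : Type*} [NormedAddCommGroup E] [NormedSpace ℝ E]
    [NormedAddCommGroup F] [NormedSpace ℝ F] {φ : E → F} {z : E × E}
    (hφ : ContDiffAt ℝ ∞ φ z.1) :
    HasFDerivAt (fun z : E × E ↦ (φ z.1, fderiv ℝ φ z.1 z.2))
      ((fderiv ℝ φ z.1 ∘L .fst ℝ E E).prod
        (fderiv ℝ φ z.1 ∘L .snd ℝ E E + (fderiv ℝ (fderiv ℝ φ) z.1).flip z.2 ∘L .fst ℝ E E)) z :=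
  ((hφ.differentiableAt (by simp)).hasFDerivAt.comp z hasFDerivAt_fst).prodMk
    (((hasFDerivAt_fderiv hφ).comp z hasFDerivAt_fst).clm_apply hasFDerivAt_snd)

theorem tangentChart_tangentMap (hf : ContMDiffAt (𝓡 n) (𝓡 d) ∞ f u.proj)
    (hx : x ∈ IsManifold.maximalAtlas (𝓡 n) ∞ M) (hx' : x' ∈ IsManifold.maximalAtlas (𝓡 d) ∞ M')
    (hpx : u.proj ∈ x.source) (hpx' : f u.proj ∈ x'.source) :
    tangentChart x' (tangentMap (𝓡 n) (𝓡 d) f u)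
      = (inCharts f x x' (tangentChart x u).1,
        fderiv ℝ (inCharts f x x') (tangentChart x u).1 (tangentChart x u).2) :=
  Prod.ext (by simp [tangentChart, inCharts, x.left_inv hpx])
    (chartDeriv_mfderiv hf hx hx' hpx hpx' u.snd)

variable [IsManifold (𝓡 n) ∞ M]

theorem chartDeriv_chartAt {p : M} (v : TangentSpace (𝓡 n) p) :
    chartDeriv (chartAt (𝔼 n) p) p v = v := by
  rw [chartDeriv, mfderiv_chartAt_eq_tangentCoordChange (mem_chart_source _ p)]
  exact tangentCoordChange_self (I := 𝓡 n) (by simp)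

theorem tangentChart_chartAt {v : TangentBundle (𝓡 n) M}
    (hv : v.proj ∈ (chartAt (𝔼 n) u.proj).source) :
    tangentChart (chartAt (𝔼 n) u.proj) v = extChartAt (𝓡 n).tangent u v := by
  have h := congrArg (TotalSpace.toProd _ _) (tangentMap_chart (I := 𝓡 n) (p := u) (q := v) hv)
  rw [Equiv.apply_symm_apply] at h
  exact h

theorem eventually_proj_mem {U : Set M} (hU : IsOpen U) (hu : u.proj ∈ U) :
    ∀ᶠ v : TangentBundle (𝓡 n) M in 𝓝 u, v.proj ∈ U :=
  (FiberBundle.continuous_proj _ _).continuousAt.eventually_mem (hU.mem_nhds hu)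

theorem hasMFDerivAt_tangentChart_chartAt (u : TangentBundle (𝓡 n) M) :
    HasMFDerivAt (𝓡 n).tangent 𝓘(ℝ, 𝔼 n × 𝔼 n) (tangentChart (chartAt (𝔼 n) u.proj)) u
      ((chartDeriv (chartAt (𝔼 n) u.proj) u.proj ∘L projDeriv u).prod
        (chartDeriv (chartAt (𝔼 n) u.proj) u.proj ∘L vertCoord u)) := by
  have hext : HasMFDerivAt (𝓡 n).tangent 𝓘(ℝ, 𝔼 n × 𝔼 n) (extChartAt (𝓡 n).tangent u) u
      (.id ℝ (𝔼 n × 𝔼 n)) := by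
    refine ⟨continuousAt_extChartAt u, (hasFDerivWithinAt_id _ _).congr_of_eventuallyEq ?_ ?_⟩
    · filter_upwards [extChartAt_target_mem_nhdsWithin (I := (𝓡 n).tangent) u] with y hy
      exact (extChartAt (𝓡 n).tangent u).right_inv hy
    · exact (extChartAt (𝓡 n).tangent u).right_inv (mem_extChartAt_target u)
  have heq : tangentChart (chartAt (𝔼 n) u.proj) =ᶠ[𝓝 u] extChartAt (𝓡 n).tangent u := by
    filter_upwards [eventually_proj_mem (chartAt (𝔼 n) u.proj).open_source (mem_chart_source _ _)]
      with v hv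
    exact tangentChart_chartAt hv
  refine (hext.congr_of_eventuallyEq heq).congr_mfderiv (ContinuousLinearMap.ext fun A ↦ ?_)
  exact Prod.ext ((chartDeriv_chartAt _).trans (projDeriv_apply u A)).symm
    (chartDeriv_chartAt _).symm

theorem chartDeriv_connector (D : Connection n M) (hx : x ∈ IsManifold.maximalAtlas (𝓡 n) ∞ M)
    (hpx : u.proj ∈ x.source) {c : OpenPartialHomeomorph M (𝔼 n)} (hc : c = chartAt (𝔼 n) u.proj)
    (A : TangentSpace (𝓡 n).tangent u) :
    chartDeriv x u.proj (connector D u A)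
      = fderiv ℝ (x ∘ c.symm) (c u.proj) (chartDeriv c u.proj (vertCoord u A))
        + fderiv ℝ (fderiv ℝ (x ∘ c.symm)) (c u.proj) (chartDeriv c u.proj (projDeriv u A))
          (chartDeriv c u.proj u.snd)
        + chartDeriv x u.proj
          (D (coordField x (chartDeriv x u.proj u.snd)) u.proj (projDeriv u A)) := by
  have hcM : c ∈ IsManifold.maximalAtlas (𝓡 n) ∞ M := hc ▸ IsManifold.chart_mem_maximalAtlas _
  have hpc : u.proj ∈ c.source := hc ▸ mem_chart_source _ _
  have hK : connector D u A
      = vertCoord u A + D (coordField c (chartDeriv c u.proj u.snd)) u.proj (projDeriv u A) := by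
    rw [hc, chartDeriv_chartAt]
    rfl
  rw [hK, connection_chart_change D hcM hx hpc hpx, map_add, map_add,
    chartDeriv_coordField hx hpx, ← chartDeriv_eq_fderiv_chart_change hcM hx hpc hpx,
    ← chartDeriv_eq_fderiv_chart_change hcM hx hpc hpx, add_assoc, add_right_inj, add_comm]

theorem hasMFDerivAt_tangentChart (D : Connection n M)
    (hx : x ∈ IsManifold.maximalAtlas (𝓡 n) ∞ M) (hpx : u.proj ∈ x.source) :
    HasMFDerivAt (𝓡 n).tangent 𝓘(ℝ, 𝔼 n × 𝔼 n) (tangentChart x) u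
      ((chartDeriv x u.proj ∘L projDeriv u).prod
        (chartDeriv x u.proj ∘L (connector D u -
          D (coordField x (chartDeriv x u.proj u.snd)) u.proj ∘L projDeriv u))) := by
  set c := chartAt (𝔼 n) u.proj with hcdef
  have hc : c ∈ IsManifold.maximalAtlas (𝓡 n) ∞ M := IsManifold.chart_mem_maximalAtlas _
  have hpc : u.proj ∈ c.source := mem_chart_source _ _
  have heq : tangentChart x =ᶠ[𝓝 u]
      (fun z ↦ (inCharts id c x z.1, fderiv ℝ (inCharts id c x) z.1 z.2)) ∘ tangentChart c := by
    filter_upwards [eventually_proj_mem c.open_source hpc, eventually_proj_mem x.open_source hpx]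
      with v hvc hvx
    have h := tangentChart_tangentMap contMDiffAt_id hc hx hvc hvx
    rwa [tangentMap_id] at h
  have hcomp := (hasFDerivAt_fderiv_uncurry (z := tangentChart c u)
    (contDiffAt_chart_change hc hx hpc hpx)).hasMFDerivAt.comp u
      (hasMFDerivAt_tangentChart_chartAt u)
  refine (hcomp.congr_of_eventuallyEq heq).congr_mfderiv
    (ContinuousLinearMap.ext fun A ↦ Prod.ext ?_ ?_)
  · exact (chartDeriv_eq_fderiv_chart_change hc hx hpc hpx _).symm
  · refine (eq_sub_of_add_eq (chartDeriv_connector D hx hpx hcdef A).symm).trans ?_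
    exact (map_sub (chartDeriv x u.proj) _ _).symm

theorem IsAffineChart.hasMFDerivAt_tangentChart {D : Connection n M} (hx : IsAffineChart D x)
    (hpx : u.proj ∈ x.source) :
    HasMFDerivAt (𝓡 n).tangent 𝓘(ℝ, 𝔼 n × 𝔼 n) (tangentChart x) u
      ((chartDeriv x u.proj ∘L projDeriv u).prod (chartDeriv x u.proj ∘L connector D u)) := by
  have h := DuallyFlat.hasMFDerivAt_tangentChart D hx.mem_maximalAtlas hpx
  rwa [hx.connection_coordField_eq_zero hpx, ContinuousLinearMap.zero_comp, sub_zero] at h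

variable [IsManifold (𝓡 d) ∞ M']

theorem projDeriv_mfderiv_tangentMap (hf : ContMDiff (𝓡 n) (𝓡 d) ∞ f)
    (A : TangentSpace (𝓡 n).tangent u) :
    projDeriv (tangentMap (𝓡 n) (𝓡 d) f u)
        (mfderiv (𝓡 n).tangent (𝓡 d).tangent (tangentMap (𝓡 n) (𝓡 d) f) u A)
      = mfderiv (𝓡 n) (𝓡 d) f u.proj (projDeriv u A) := by
  have hcomp := mfderiv_comp_apply u
    (mdifferentiableAt_proj _ : MDifferentiableAt (𝓡 d).tangent (𝓡 d) TotalSpace.proj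
      (tangentMap (𝓡 n) (𝓡 d) f u))
    ((hf.contMDiff_tangentMap (m := ∞) (by simp)).mdifferentiableAt (by simp)) A
  rw [projDeriv, ← hcomp]
  exact mfderiv_comp_apply u (hf.mdifferentiableAt (by simp)) (mdifferentiableAt_proj _) A

theorem chartDeriv_connector_mfderiv_tangentMap {D : Connection n M} {D' : Connection d M'}
    (hf : ContMDiff (𝓡 n) (𝓡 d) ∞ f) (hx : IsAffineChart D x) (hx' : IsAffineChart D' x')
    (hpx : u.proj ∈ x.source) (hpx' : f u.proj ∈ x'.source) (A : TangentSpace (𝓡 n).tangent u) :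
    chartDeriv x' (f u.proj) (connector D' (tangentMap (𝓡 n) (𝓡 d) f u)
        (mfderiv (𝓡 n).tangent (𝓡 d).tangent (tangentMap (𝓡 n) (𝓡 d) f) u A))
      = chartDeriv x' (f u.proj) (mfderiv (𝓡 n) (𝓡 d) f u.proj (connector D u A))
        + fderiv ℝ (fderiv ℝ (inCharts f x x')) (x u.proj)
          (chartDeriv x u.proj (projDeriv u A)) (chartDeriv x u.proj u.snd) := by
  have heq : tangentChart x' ∘ tangentMap (𝓡 n) (𝓡 d) f =ᶠ[𝓝 u]
      (fun z ↦ (inCharts f x x' z.1, fderiv ℝ (inCharts f x x') z.1 z.2)) ∘ tangentChart x := by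
    filter_upwards [eventually_proj_mem x.open_source hpx,
      eventually_proj_mem (x'.open_source.preimage hf.continuous) hpx'] with v hvx hvx'
    exact tangentChart_tangentMap hf.contMDiffAt hx.mem_maximalAtlas hx'.mem_maximalAtlas hvx hvx'
  have hleft := (hx'.hasMFDerivAt_tangentChart (u := tangentMap (𝓡 n) (𝓡 d) f u) hpx').comp u
    ((hf.contMDiff_tangentMap (m := ∞) (by simp)).mdifferentiableAt (by simp)).hasMFDerivAt
  have hright := (hasFDerivAt_fderiv_uncurry (z := tangentChart x u) (contDiffAt_inCharts
    hf.contMDiffAt hx.mem_maximalAtlas hx'.mem_maximalAtlas hpx hpx')).hasMFDerivAt.comp u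
      (hx.hasMFDerivAt_tangentChart hpx)
  rw [chartDeriv_mfderiv hf.contMDiffAt hx.mem_maximalAtlas hx'.mem_maximalAtlas hpx hpx']
  exact congrArg (fun L ↦ (L A).2)
    (hasMFDerivAt_unique hleft (hright.congr_of_eventuallyEq heq))

end TangentChart

section Main

variable {n d : ℕ} {M M' : Type*} [TopologicalSpace M] [ChartedSpace (𝔼 n) M]
  [IsManifold (𝓡 n) ∞ M] [TopologicalSpace M'] [ChartedSpace (𝔼 d) M'] [IsManifold (𝓡 d) ∞ M']
  {D : Connection n M} {D' : Connection d M'} {f : M → M'} {p : M}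
  {x : OpenPartialHomeomorph M (𝔼 n)} {x' : OpenPartialHomeomorph M' (𝔼 d)}

theorem eq_iff_projDeriv_eq_and_connector_eq {u : TangentBundle (𝓡 n) M}
    {A B : TangentSpace (𝓡 n).tangent u} :
    A = B ↔ projDeriv u A = projDeriv u B ∧ connector D u A = connector D u B :=
  (splitEquiv D u).injective.eq_iff.symm.trans Prod.ext_iff

theorem exists_projDeriv_eq_and_connector_eq (D : Connection n M) (u : TangentBundle (𝓡 n) M)
    (v w : TangentSpace (𝓡 n) u.proj) : ∃ A, projDeriv u A = v ∧ connector D u A = w :=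
  ((splitEquiv D u).surjective (v, w)).imp fun _ hA ↦ Prod.ext_iff.1 hA

theorem projDeriv_complexStructure (u : TangentBundle (𝓡 n) M)
    (A : TangentSpace (𝓡 n).tangent u) :
    projDeriv u (complexStructure D u A) = -connector D u A :=
  congrArg Prod.fst ((splitEquiv D u).apply_symm_apply _)

theorem connector_complexStructure (u : TangentBundle (𝓡 n) M)
    (A : TangentSpace (𝓡 n).tangent u) :
    connector D u (complexStructure D u A) = projDeriv u A :=
  congrArg Prod.snd ((splitEquiv D u).apply_symm_apply _)

/-- The condition `K' ∘ (f_*)_* = f_* ∘ K` on the fibre of `TTM → M` over `p`. It says that the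
second fundamental form `∇df` vanishes at `p`. -/
def IntertwinesConnectorsAt (D : Connection n M) (D' : Connection d M') (f : M → M') (p : M) :
    Prop :=
  ∀ (w : TangentSpace (𝓡 n) p) (A : TangentSpace (𝓡 n).tangent (⟨p, w⟩ : TangentBundle (𝓡 n) M)),
    connector D' (tangentMap (𝓡 n) (𝓡 d) f ⟨p, w⟩)
        (mfderiv (𝓡 n).tangent (𝓡 d).tangent (tangentMap (𝓡 n) (𝓡 d) f) ⟨p, w⟩ A)
      = mfderiv (𝓡 n) (𝓡 d) f p (connector D ⟨p, w⟩ A)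

theorem isHolomorphic_tangentMap_iff (hf : ContMDiff (𝓡 n) (𝓡 d) ∞ f) :
    IsHolomorphic (𝓡 n).tangent (𝓡 d).tangent (complexStructure D) (complexStructure D')
        (tangentMap (𝓡 n) (𝓡 d) f) ↔ ∀ p, IntertwinesConnectorsAt D D' f p := by
  have hcomm : ∀ (u : TangentBundle (𝓡 n) M) (A : TangentSpace (𝓡 n).tangent u),
      mfderiv (𝓡 n).tangent (𝓡 d).tangent (tangentMap (𝓡 n) (𝓡 d) f) u (complexStructure D u A)
          = complexStructure D' (tangentMap (𝓡 n) (𝓡 d) f u)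
            (mfderiv (𝓡 n).tangent (𝓡 d).tangent (tangentMap (𝓡 n) (𝓡 d) f) u A)
        ↔ connector D' (tangentMap (𝓡 n) (𝓡 d) f u)
            (mfderiv (𝓡 n).tangent (𝓡 d).tangent (tangentMap (𝓡 n) (𝓡 d) f) u A)
          = mfderiv (𝓡 n) (𝓡 d) f u.proj (connector D u A)
        ∧ connector D' (tangentMap (𝓡 n) (𝓡 d) f u)
            (mfderiv (𝓡 n).tangent (𝓡 d).tangent (tangentMap (𝓡 n) (𝓡 d) f) u
              (complexStructure D u A))
          = mfderiv (𝓡 n) (𝓡 d) f u.proj (connector D u (complexStructure D u A)) := by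
    intro u A
    rw [eq_iff_projDeriv_eq_and_connector_eq (D := D'), projDeriv_complexStructure,
      connector_complexStructure, projDeriv_mfderiv_tangentMap hf, projDeriv_mfderiv_tangentMap hf,
      projDeriv_complexStructure, connector_complexStructure, map_neg]
    exact and_congr_left' (neg_inj.trans eq_comm)
  refine ⟨fun h p w A ↦ ((hcomm _ A).1 (h.2 _ A)).1, fun h ↦ ?_⟩
  exact ⟨hf.contMDiff_tangentMap (by simp), fun u A ↦ (hcomm u A).2 ⟨h _ _ _, h _ _ _⟩⟩

theorem IsAffineChart.intertwinesConnectorsAt_iff (hx : IsAffineChart D x)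
    (hx' : IsAffineChart D' x') (hf : ContMDiff (𝓡 n) (𝓡 d) ∞ f) (hpx : p ∈ x.source)
    (hpx' : f p ∈ x'.source) :
    IntertwinesConnectorsAt D D' f p ↔ fderiv ℝ (fderiv ℝ (inCharts f x x')) (x p) = 0 := by
  have hK := fun (w : TangentSpace (𝓡 n) p) ↦ chartDeriv_connector_mfderiv_tangentMap
    (u := ⟨p, w⟩) hf hx hx' hpx hpx'
  constructor
  · intro h
    ext1 a
    ext1 b
    obtain ⟨A, hA, -⟩ := exists_projDeriv_eq_and_connector_eq D
      (⟨p, coordField x b p⟩ : TangentBundle (𝓡 n) M) (coordField x a p)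
      (0 : TangentSpace (𝓡 n) p)
    have hb := hK (coordField x b p) A
    rw [h, hA] at hb
    simpa [chartDeriv_coordField hx.mem_maximalAtlas hpx] using hb
  · intro h w A
    refine (isInvertible_chartDeriv hx'.mem_maximalAtlas hpx').injective ((hK w A).trans ?_)
    rw [h]
    exact add_zero _

theorem fderiv_fderiv_affineMap {E F : Type*} [NormedAddCommGroup E] [NormedSpace ℝ E]
    [FiniteDimensional ℝ E] [NormedAddCommGroup F] [NormedSpace ℝ F] (a : E →ᵃ[ℝ] F) (y : E) :
    fderiv ℝ (fderiv ℝ a) y = 0 := by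
  let a' : E →ᴬ[ℝ] F := ⟨a, a.continuous_of_finiteDimensional⟩
  have ha : fderiv ℝ a = fun _ ↦ a'.contLinear := funext fun _ ↦ a'.fderiv
  rw [ha, fderiv_fun_const, Pi.zero_apply]

theorem exists_affineMap_eqOn {E F : Type*} [NormedAddCommGroup E] [NormedSpace ℝ E]
    [NormedAddCommGroup F] [NormedSpace ℝ F] {φ : E → F} {s : Set E} (hs : IsOpen s)
    (hs' : IsPreconnected s) (hφ : ∀ y ∈ s, ContDiffAt ℝ ∞ φ y)
    (hφ'' : ∀ y ∈ s, fderiv ℝ (fderiv ℝ φ) y = 0) : ∃ a : E →ᵃ[ℝ] F, EqOn φ a s := by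
  obtain ⟨L, hL⟩ := hs.exists_is_const_of_fderiv_eq_zero hs'
    (fun y hy ↦ (hasFDerivAt_fderiv (hφ y hy)).differentiableAt.differentiableWithinAt) hφ''
  obtain ⟨b, hb⟩ := hs.exists_eq_add_of_fderiv_eq hs'
    (fun y hy ↦ ((hφ y hy).differentiableAt (by simp)).differentiableWithinAt)
    L.differentiable.differentiableOn (fun y hy ↦ (hL y hy).trans L.fderiv.symm)
  exact ⟨L.toLinearMap.toAffineMap + AffineMap.const ℝ E b, hb⟩

theorem IsAffine.intertwinesConnectorsAt (h : IsAffine D D' f)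
    (hf : ContMDiff (𝓡 n) (𝓡 d) ∞ f) (p : M) : IntertwinesConnectorsAt D D' f p := by
  obtain ⟨x, x', a, hx, hx', hpx, hmaps, ha⟩ := h p
  have heq : inCharts f x x' =ᶠ[𝓝 (x p)] a := by
    filter_upwards [x.open_target.mem_nhds (x.map_source hpx)] with y hy
    exact ha y hy
  rw [hx.intertwinesConnectorsAt_iff hx' hf hpx (hmaps hpx), heq.fderiv.fderiv_eq,
    fderiv_fderiv_affineMap]

theorem isAffine_of_intertwinesConnectorsAt [T2Space M] [T2Space M']
    (hD : D.ContMDiffCovariantDerivative ∞) (hflat : IsFlat D)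
    (hD' : D'.ContMDiffCovariantDerivative ∞) (hflat' : IsFlat D')
    (hf : ContMDiff (𝓡 n) (𝓡 d) ∞ f) (h : ∀ p, IntertwinesConnectorsAt D D' f p) :
    IsAffine D D' f := by
  intro p
  obtain ⟨x', hx', hpx'⟩ := exists_isAffineChart hD' hflat' (f p)
  obtain ⟨x, hx, hpx, hmaps, hconn⟩ := exists_isAffineChart_subset hD hflat
    (x'.open_source.preimage hf.continuous) hpx'
  have hφ : ∀ y ∈ x.target, ContDiffAt ℝ ∞ (inCharts f x x') y := fun y hy ↦
    x.right_inv hy ▸ contDiffAt_inCharts hf.contMDiffAt hx.mem_maximalAtlas hx'.mem_maximalAtlas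
      (x.map_target hy) (hmaps (x.map_target hy))
  have hφ'' : ∀ y ∈ x.target, fderiv ℝ (fderiv ℝ (inCharts f x x')) y = 0 := fun y hy ↦
    x.right_inv hy ▸ (hx.intertwinesConnectorsAt_iff hx' hf (x.map_target hy)
      (hmaps (x.map_target hy))).1 (h _)
  obtain ⟨a, ha⟩ := exists_affineMap_eqOn x.open_target hconn hφ hφ''
  exact ⟨x, x', a, hx, hx', hpx, hmaps, ha⟩

theorem isHolomorphic_tangentMap_iff_isAffine [T2Space M] [T2Space M']
    (hD : D.ContMDiffCovariantDerivative ∞) (hflat : IsFlat D)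
    (hD' : D'.ContMDiffCovariantDerivative ∞) (hflat' : IsFlat D')
    (hf : ContMDiff (𝓡 n) (𝓡 d) ∞ f) :
    IsHolomorphic (𝓡 n).tangent (𝓡 d).tangent (complexStructure D) (complexStructure D')
        (tangentMap (𝓡 n) (𝓡 d) f) ↔ IsAffine D D' f :=
  (isHolomorphic_tangentMap_iff hf).trans
    ⟨isAffine_of_intertwinesConnectorsAt hD hflat hD' hflat' hf, fun h ↦
      h.intertwinesConnectorsAt hf⟩

theorem isIsometric_tangentMap_iff (h : ∀ p, IntertwinesConnectorsAt D D' f p)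
    (hf : ContMDiff (𝓡 n) (𝓡 d) ∞ f) (g : Metric n M) (g' : Metric d M') :
    IsIsometric (𝓡 n).tangent (𝓡 d).tangent (tangentMetric g D) (tangentMetric g' D')
        (tangentMap (𝓡 n) (𝓡 d) f)
      ↔ IsIsometric (𝓡 n) (𝓡 d) (fun p v w ↦ g.inner p v w) (fun p v w ↦ g'.inner p v w) f := by
  have hpull : ∀ (u : TangentBundle (𝓡 n) M) (A B : TangentSpace (𝓡 n).tangent u),
      tangentMetric g' D' (tangentMap (𝓡 n) (𝓡 d) f u)
        (mfderiv (𝓡 n).tangent (𝓡 d).tangent (tangentMap (𝓡 n) (𝓡 d) f) u A)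
        (mfderiv (𝓡 n).tangent (𝓡 d).tangent (tangentMap (𝓡 n) (𝓡 d) f) u B)
      = g'.inner (f u.proj) (mfderiv (𝓡 n) (𝓡 d) f u.proj (projDeriv u A))
          (mfderiv (𝓡 n) (𝓡 d) f u.proj (projDeriv u B))
        + g'.inner (f u.proj) (mfderiv (𝓡 n) (𝓡 d) f u.proj (connector D u A))
          (mfderiv (𝓡 n) (𝓡 d) f u.proj (connector D u B)) := by
    intro u A B
    rw [← projDeriv_mfderiv_tangentMap hf, ← projDeriv_mfderiv_tangentMap hf, ← h _ u.snd A,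
      ← h _ u.snd B]
    rfl
  constructor
  · rintro ⟨-, hT⟩
    refine ⟨hf, fun p v w ↦ ?_⟩
    obtain ⟨A, hA, hA'⟩ := exists_projDeriv_eq_and_connector_eq D ⟨p, 0⟩ v 0
    obtain ⟨B, hB, hB'⟩ := exists_projDeriv_eq_and_connector_eq D ⟨p, 0⟩ w 0
    have hAB : _ = g.inner p (projDeriv _ A) (projDeriv _ B)
        + g.inner p (connector D _ A) (connector D _ B) := (hpull _ A B).symm.trans (hT _ A B)
    rw [hA, hA', hB, hB', map_zero, map_zero, map_zero, add_zero, add_zero] at hAB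
    exact hAB
  · rintro ⟨-, hi⟩
    refine ⟨hf.contMDiff_tangentMap (by simp), fun u A B ↦ (hpull u A B).trans ?_⟩
    exact congrArg₂ (· + ·) (hi _ _ _) (hi _ _ _)

theorem isSmoothImmersion_tangentMap_iff (h : ∀ p, IntertwinesConnectorsAt D D' f p)
    (hf : ContMDiff (𝓡 n) (𝓡 d) ∞ f) :
    IsSmoothImmersion (𝓡 n).tangent (𝓡 d).tangent (tangentMap (𝓡 n) (𝓡 d) f)
      ↔ IsSmoothImmersion (𝓡 n) (𝓡 d) f := by
  have heq : ∀ (u : TangentBundle (𝓡 n) M) (A B : TangentSpace (𝓡 n).tangent u),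
      mfderiv (𝓡 n).tangent (𝓡 d).tangent (tangentMap (𝓡 n) (𝓡 d) f) u A
          = mfderiv (𝓡 n).tangent (𝓡 d).tangent (tangentMap (𝓡 n) (𝓡 d) f) u B
        ↔ mfderiv (𝓡 n) (𝓡 d) f u.proj (projDeriv u A)
            = mfderiv (𝓡 n) (𝓡 d) f u.proj (projDeriv u B)
          ∧ mfderiv (𝓡 n) (𝓡 d) f u.proj (connector D u A)
            = mfderiv (𝓡 n) (𝓡 d) f u.proj (connector D u B) := by
    intro u A B
    rw [eq_iff_projDeriv_eq_and_connector_eq (D := D'), projDeriv_mfderiv_tangentMap hf,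
      projDeriv_mfderiv_tangentMap hf, ← h _ u.snd A, ← h _ u.snd B]
    rfl
  constructor
  · rintro ⟨-, hinj⟩
    refine ⟨hf, fun p v w hvw ↦ ?_⟩
    obtain ⟨A, hA, hA'⟩ := exists_projDeriv_eq_and_connector_eq D ⟨p, 0⟩ v 0
    obtain ⟨B, hB, hB'⟩ := exists_projDeriv_eq_and_connector_eq D ⟨p, 0⟩ w 0
    have hAB : A = B := hinj _ ((heq _ A B).2 ⟨by rw [hA, hB]; exact hvw, by rw [hA', hB']⟩)
    rw [← hA, ← hB, hAB]
  · rintro ⟨-, hinj⟩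
    refine ⟨hf.contMDiff_tangentMap (by simp), fun u A B hAB ↦ ?_⟩
    obtain ⟨hproj, hconn⟩ := (heq u A B).1 hAB
    exact eq_iff_projDeriv_eq_and_connector_eq.2 ⟨hinj _ hproj, hinj _ hconn⟩

end Main

end DuallyFlat

end

open DuallyFlat in
theorem proposition2p19_general {n d : ℕ} {M M' : Type*}
    [TopologicalSpace M] [T2Space M] [ChartedSpace (EuclideanSpace ℝ (Fin n)) M]
    [IsManifold (𝓡 n) ∞ M] [TopologicalSpace M'] [T2Space M']
    [ChartedSpace (EuclideanSpace ℝ (Fin d)) M'] [IsManifold (𝓡 d) ∞ M']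
    {D : Connection n M} {D' : Connection d M'} {f : M → M'}
    (hD : D.ContMDiffCovariantDerivative ∞) (hflat : IsFlat D)
    (hD' : D'.ContMDiffCovariantDerivative ∞) (hflat' : IsFlat D')
    (g : Metric n M) (g' : Metric d M') (hf : ContMDiff (𝓡 n) (𝓡 d) ∞ f) :
    (IsHolomorphic (𝓡 n).tangent (𝓡 d).tangent (complexStructure D) (complexStructure D')
        (tangentMap (𝓡 n) (𝓡 d) f) ↔ IsAffine D D' f) ∧
    (IsAffine D D' f →
      (IsIsometric (𝓡 n).tangent (𝓡 d).tangent (tangentMetric g D) (tangentMetric g' D')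
          (tangentMap (𝓡 n) (𝓡 d) f)
        ↔ IsIsometric (𝓡 n) (𝓡 d) (fun p v w ↦ g.inner p v w) (fun p v w ↦ g'.inner p v w) f)) ∧
    (IsKahlerImmersion (𝓡 n).tangent (𝓡 d).tangent (tangentMetric g D) (complexStructure D)
        (tangentMetric g' D') (complexStructure D') (tangentMap (𝓡 n) (𝓡 d) f)
      ↔ IsIsometric (𝓡 n) (𝓡 d) (fun p v w ↦ g.inner p v w) (fun p v w ↦ g'.inner p v w) f
        ∧ IsAffine D D' f ∧ IsSmoothImmersion (𝓡 n) (𝓡 d) f) := by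
  have hholo := isHolomorphic_tangentMap_iff_isAffine hD hflat hD' hflat' hf
  have hisom := fun h : IsAffine D D' f ↦
    isIsometric_tangentMap_iff (h.intertwinesConnectorsAt hf) hf g g'
  have himm := fun h : IsAffine D D' f ↦
    isSmoothImmersion_tangentMap_iff (h.intertwinesConnectorsAt hf) hf
  refine ⟨hholo, hisom, ?_, ?_⟩
  · rintro ⟨h_imm, h_holo, h_isom⟩
    have h := hholo.1 h_holo
    exact ⟨(hisom h).1 h_isom, h, (himm h).1 h_imm⟩
  · rintro ⟨h_isom, h, h_imm⟩
    exact ⟨(himm h).2 h_imm, hholo.2 h, (hisom h).2 h_isom⟩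

theorem proposition2p19 {n d : ℕ} {M M' : Type*}
    [TopologicalSpace M] [T2Space M] [SecondCountableTopology M] [ConnectedSpace M]
    [ChartedSpace (EuclideanSpace ℝ (Fin n)) M] [IsManifold (𝓡 n) ∞ M]
    [TopologicalSpace M'] [T2Space M'] [SecondCountableTopology M'] [ConnectedSpace M']
    [ChartedSpace (EuclideanSpace ℝ (Fin d)) M'] [IsManifold (𝓡 d) ∞ M']
    (S : DuallyFlat.DuallyFlatStructure n M) (S' : DuallyFlat.DuallyFlatStructure d M')
    (f : M → M') (hf : ContMDiff (𝓡 n) (𝓡 d) ∞ f) :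
    (DuallyFlat.IsHolomorphic (𝓡 n).tangent (𝓡 d).tangent
        (DuallyFlat.complexStructure S.conn) (DuallyFlat.complexStructure S'.conn)
        (tangentMap (𝓡 n) (𝓡 d) f)
      ↔ DuallyFlat.IsAffine S.conn S'.conn f) ∧
    (DuallyFlat.IsAffine S.conn S'.conn f →
      (DuallyFlat.IsIsometric (𝓡 n).tangent (𝓡 d).tangent
          (DuallyFlat.tangentMetric S.metric S.conn) (DuallyFlat.tangentMetric S'.metric S'.conn)
          (tangentMap (𝓡 n) (𝓡 d) f)
        ↔ DuallyFlat.IsIsometric (𝓡 n) (𝓡 d)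
          (fun p v w ↦ S.metric.inner p v w) (fun p v w ↦ S'.metric.inner p v w) f)) ∧
    (DuallyFlat.IsKahlerImmersion (𝓡 n).tangent (𝓡 d).tangent
        (DuallyFlat.tangentMetric S.metric S.conn) (DuallyFlat.complexStructure S.conn)
        (DuallyFlat.tangentMetric S'.metric S'.conn) (DuallyFlat.complexStructure S'.conn)
        (tangentMap (𝓡 n) (𝓡 d) f)
      ↔ DuallyFlat.IsIsometric (𝓡 n) (𝓡 d)
            (fun p v w ↦ S.metric.inner p v w) (fun p v w ↦ S'.metric.inner p v w) f
          ∧ DuallyFlat.IsAffine S.conn S'.conn f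
          ∧ DuallyFlat.IsSmoothImmersion (𝓡 n) (𝓡 d) f) :=
  proposition2p19_general S.smooth_conn S.flat_conn S'.smooth_conn S'.flat_conn S.metric S'.metric
    hf
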